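/- Let $\alpha$ be an indeterminate, let $0\le N\le n$ be integers, and let $\Lambda_n^N\otimes\mathbb Q(\alpha)$ be the space of symmetric polynomials in $x_1,\dots,x_n$ over $\mathbb Q(\alpha)$ that are homogeneous of degree $N$. It has as basis the power sums $p_\lambda=p_{\lambda_1}p_{\lambda_2}\cdots$ with $p_i=\sum_k x_k^i$, where $\lambda$ runs over the partitions of $N$; let $\langle\cdot,\cdot\rangle$ be the bilinear form on it with $$\langle p_\lambda,p_\mu\rangle=\delta_{\lambda\mu}\,z_\lambda\,\alpha^{\ell(\lambda)},\qquad z_\lambda=\prod_{i\ge1} i^{m_i}\,m_i!,$$ where $m_i$ is the number of parts of $\lambda$ equal to $i$ and $\ell(\lambda)$ is the number of parts. Let $m_\mu$ be the symmetric monomials and let $\le$ be the dominance order on partitions of $N$. Let $J_\lambda=J_\lambda(x_1,\dots,x_n;\alpha)\in\Lambda_n^N\otimes\mathbb Q(\alpha)$ ($\lambda$ a partition of $N$) be the Jack polynomials, i.e. the family specified by (i) $\langle J_\lambda,J_\mu\rangle=0$ if $\lambda\ne\mu$; (ii) $J_\lambda=\sum_{\mu\le\lambda}v_{\lambda\mu}(\alpha)\,m_\mu$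 with $v_{\lambda\mu}(\alpha)\in\mathbb Q(\alpha)$; (iii) $v_{\lambda,1^N}(\alpha)=N!$. Then for all partitions $\mu\le\lambda$ of $N$ the coefficient $v_{\lambda\mu}(\alpha)$ is a polynomial in $\alpha$ with integer coefficients. -/

import Mathlib

namespace JackPoly

open MvPolynomial

/-- The field `ℚ(α)` of rational functions in one parameter. -/
abbrev Qα : Type := RatFunc ℚ

/-- The parameter `α`. -/
noncomputable abbrev α : Qα := RatFunc.X

/-! ### Partitions -/

section Partitions

variable {N : ℕ}

/-- `λ₁ + ⋯ + λᵢ`, where `λ₁ ≥ λ₂ ≥ ⋯` are the parts of `lam` (extended by zeros). -/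
def partialSum (lam : N.Partition) (i : ℕ) : ℕ :=
  ((lam.parts.sort (· ≥ ·)).take i).sum

/-- Dominance order: `DomLE μ λ` means `μ ≤ λ`. -/
def DomLE (mu lam : N.Partition) : Prop :=
  ∀ i, partialSum mu i ≤ partialSum lam i

/-- The number of parts `ℓ(λ)`. -/
def len (lam : N.Partition) : ℕ := lam.parts.card

/-- `z_λ = 1^{m₁} m₁! 2^{m₂} m₂! ⋯`, with `mᵢ` the multiplicity of `i` in `λ`. -/
def zee (lam : N.Partition) : ℕ :=
  ∏ i ∈ lam.parts.toFinset, i ^ lam.parts.count i * (lam.parts.count i).factorial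

/-- The partition `1^N`. -/
def onePart (N : ℕ) : N.Partition where
  parts := Multiset.replicate N 1
  parts_pos := by
    intro i hi
    rw [Multiset.eq_of_mem_replicate hi]
    exact Nat.one_pos
  parts_sum := by simp

end Partitions

/-! ### Homogeneous symmetric polynomials and the power sum basis -/

/-- The homogeneous component of degree `N` of `Λ_n ⊗ ℚ(α)`: symmetric polynomials in
`x₁, …, x_n` over `ℚ(α)`, homogeneous of degree `N`. -/
noncomputable def SymHom (n N : ℕ) : Submodule Qα (MvPolynomial (Fin n) Qα) :=
  Subalgebra.toSubmodule (symmetricSubalgebra (Fin n) Qα) ⊓ homogeneousSubmodule (Fin n) Qα N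

/-- The multiset of nonzero exponents of a monomial. -/
def vals {n : ℕ} (d : Fin n →₀ ℕ) : Multiset ℕ := d.support.val.map d

lemma vals_sum {n : ℕ} (d : Fin n →₀ ℕ) : (vals d).sum = d.degree := rfl

lemma vals_single_add {n : ℕ} (e : Fin n →₀ ℕ) (i : Fin n) {a : ℕ} (ha : 0 < a)
    (hi : e i = 0) : vals (Finsupp.single i a + e) = a ::ₘ vals e := by
  classical
  have hs : (Finsupp.single i a + e).support = insert i e.support := by
    ext j
    by_cases h : j = i
    · subst h; simp [ha.ne']
    · simp [h]
  have hni : i ∉ e.support := by simpa using hi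
  unfold vals
  rw [hs, Finset.insert_val_of_notMem hni, Multiset.map_cons]
  congr 1
  · simp [hi]
  · apply Multiset.map_congr rfl
    intro j hj
    have : j ≠ i := by
      rintro rfl; exact hni hj
    simp [this.symm]

lemma card_vals {n : ℕ} (d : Fin n →₀ ℕ) : (vals d).card = d.support.card := by
  simp [vals]

lemma psum_support {n : ℕ} {R : Type*} [CommSemiring R] {a : ℕ} {d : Fin n →₀ ℕ}
    (hd : coeff d (psum (Fin n) R a) ≠ 0) : ∃ i, d = Finsupp.single i a := by
  classical
  by_contra! h
  apply hd
  simp only [psum, coeff_sum, coeff_X_pow]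
  exact Finset.sum_eq_zero fun i _ => if_neg (fun h' => h i h'.symm)

/-- A monomial of a product of power sums has at most as many variables as there are factors,
and if it has as many, its exponents are those of the factors. -/
lemma vals_of_coeff_ne {n : ℕ} {R : Type*} [CommSemiring R] (s : Multiset ℕ) :
    (∀ a ∈ s, 0 < a) → ∀ d : Fin n →₀ ℕ, coeff d ((s.map (psum (Fin n) R)).prod) ≠ 0 →
      (vals d).card ≤ s.card ∧ ((vals d).card = s.card → vals d = s) := by
  classical
  induction s using Multiset.induction with
  | empty =>
    intro _ d hd
    have : d = 0 := by
      by_contra h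
      apply hd
      simp [coeff_one, Ne.symm h]
    subst this
    simp [vals]
  | cons a s ih =>
    intro hpos d hd
    rw [Multiset.map_cons, Multiset.prod_cons, coeff_mul] at hd
    obtain ⟨⟨x, e⟩, hxe, hne⟩ := Finset.exists_ne_zero_of_sum_ne_zero hd
    obtain ⟨i, hi⟩ := psum_support (left_ne_zero_of_mul hne)
    have he := ih (fun b hb => hpos b (Multiset.mem_cons_of_mem hb)) e
      (right_ne_zero_of_mul hne)
    have hd' : d = Finsupp.single i a + e := by
      rw [← Finset.HasAntidiagonal.mem_antidiagonal.mp hxe, ← hi]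
    have ha : 0 < a := hpos a (Multiset.mem_cons_self a s)
    by_cases hei : e i = 0
    · rw [hd', vals_single_add e i ha hei]
      simp only [Multiset.card_cons]
      refine ⟨by omega, fun h => ?_⟩
      rw [he.2 (by omega)]
    · have hs : (Finsupp.single i a + e).support = e.support := by
        ext j
        by_cases h : j = i
        · subst h; simp [hei]
        · simp [Ne.symm h]
      have hc : (vals d).card = (vals e).card := by
        rw [card_vals, card_vals, hd', hs]
      rw [hc, Multiset.card_cons]
      exact ⟨by omega, fun h => by omega⟩

lemma coeff_prod_psum_nat {n : ℕ} (s : Multiset ℕ) :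
    (∀ a ∈ s, 0 < a) → ∀ d : Fin n →₀ ℕ, vals d = s →
      coeff d ((s.map (psum (Fin n) ℕ)).prod) ≠ 0 := by
  classical
  induction s using Multiset.induction with
  | empty =>
    intro _ d hd
    have : d = 0 := by
      simpa [vals] using hd
    subst this
    simp
  | cons a s ih =>
    intro hpos d hd
    have ha : 0 < a := hpos a (Multiset.mem_cons_self a s)
    have hmem : a ∈ vals d := by rw [hd]; exact Multiset.mem_cons_self a s
    obtain ⟨i, -, hi⟩ := Multiset.mem_map.mp hmem
    have hdec : Finsupp.single i a + d.erase i = d := by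
      rw [← hi, Finsupp.single_add_erase]
    have hv : vals (d.erase i) = s := by
      have := vals_single_add (d.erase i) i ha (by simp)
      rw [hdec, hd] at this
      exact ((Multiset.cons_inj_right a).mp this).symm
    have h1 := ih (fun b hb => hpos b (Multiset.mem_cons_of_mem hb)) _ hv
    rw [Multiset.map_cons, Multiset.prod_cons, coeff_mul]
    intro h0
    have h2 := (Finset.sum_eq_zero_iff.mp h0) (Finsupp.single i a, d.erase i)
      (Finset.HasAntidiagonal.mem_antidiagonal.mpr hdec)
    rcases mul_eq_zero.mp h2 with h | h
    · simp only [psum, coeff_sum, coeff_X_pow] at h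
      have := (Finset.sum_eq_zero_iff.mp h) i (Finset.mem_univ i)
      simp at this
    · exact h1 h

lemma coeff_prod_psum {n : ℕ} (s : Multiset ℕ) (hs : ∀ a ∈ s, 0 < a) (d : Fin n →₀ ℕ)
    (hd : vals d = s) : coeff d ((s.map (psum (Fin n) Qα)).prod) ≠ 0 := by
  have h : (s.map (psum (Fin n) Qα)).prod
      = MvPolynomial.map (Nat.castRingHom Qα) ((s.map (psum (Fin n) ℕ)).prod) := by
    rw [← Multiset.prod_hom, Multiset.map_map]
    congr 1
    apply Multiset.map_congr rfl
    intro a _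
    simp [psum]
  rw [h, coeff_map]
  simpa using coeff_prod_psum_nat s hs d hd

/-- Every multiset of at most `n` positive integers is the multiset of nonzero exponents of a
monomial in `n` variables. -/
lemma exists_vals {n : ℕ} (s : Multiset ℕ) :
    (∀ a ∈ s, 0 < a) → s.card ≤ n → ∃ d : Fin n →₀ ℕ, vals d = s := by
  classical
  induction s using Multiset.induction with
  | empty => exact fun _ _ => ⟨0, by simp [vals]⟩
  | cons a s ih =>
    intro hpos hc
    rw [Multiset.card_cons] at hc
    obtain ⟨e, he⟩ := ih (fun b hb => hpos b (Multiset.mem_cons_of_mem hb)) (by omega)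
    have hcard : e.support.card < (Finset.univ : Finset (Fin n)).card := by
      rw [← card_vals, he]; simp; omega
    obtain ⟨i, -, hi⟩ := Finset.exists_mem_notMem_of_card_lt_card hcard
    refine ⟨Finsupp.single i a + e, ?_⟩
    rw [vals_single_add e i (hpos a (Multiset.mem_cons_self a s)) (by simpa using hi), he]

lemma card_parts_le {N : ℕ} (lam : N.Partition) : lam.parts.card ≤ N := by
  have h := Multiset.card_nsmul_le_sum (s := lam.parts) (a := 1)
    (fun x hx => lam.parts_pos hx)
  rw [lam.parts_sum] at h
  simpa using h

lemma psumPart_mem {n N : ℕ} (lam : N.Partition) : psumPart (Fin n) Qα lam ∈ SymHom n N := by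
  refine ⟨?_, ?_⟩
  · change psumPart (Fin n) Qα lam ∈ symmetricSubalgebra (Fin n) Qα
    apply Subalgebra.multiset_prod_mem
    intro p hp
    obtain ⟨a, -, rfl⟩ := Multiset.mem_map.mp hp
    exact psum_isSymmetric _ _ a
  · change (psumPart (Fin n) Qα lam).IsHomogeneous N
    have key : ∀ s : Multiset ℕ, ((s.map (psum (Fin n) Qα)).prod).IsHomogeneous s.sum := by
      intro s
      induction s using Multiset.induction with
      | empty => simpa using isHomogeneous_one (Fin n) Qα
      | cons a s ih =>
        rw [Multiset.map_cons, Multiset.prod_cons, Multiset.sum_cons]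
        refine IsHomogeneous.mul ?_ ih
        exact IsHomogeneous.sum _ _ _ fun i _ => isHomogeneous_X_pow i a
    have := key lam.parts
    rwa [lam.parts_sum] at this

/-- The power sum `p_λ` as an element of the degree `N` component. -/
noncomputable def pElt (n : ℕ) {N : ℕ} (lam : N.Partition) : SymHom n N :=
  ⟨psumPart (Fin n) Qα lam, psumPart_mem lam⟩

lemma pElt_linearIndependent {n N : ℕ} (h : N ≤ n) :
    LinearIndependent Qα (pElt n : N.Partition → SymHom n N) := by
  classical
  rw [Fintype.linearIndependent_iff]
  intro g hg
  by_contra! hne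
  obtain ⟨i₀, hi₀⟩ := hne
  obtain ⟨lam, hlam, hmax⟩ := Finset.exists_max_image
    (Finset.univ.filter fun mu : N.Partition => g mu ≠ 0) (fun mu => mu.parts.card)
    ⟨i₀, by simpa using hi₀⟩
  obtain ⟨d, hd⟩ := exists_vals (n := n) lam.parts (fun a ha => lam.parts_pos ha)
    ((card_parts_le lam).trans h)
  have hg' : ∑ mu : N.Partition, g mu * coeff d (psumPart (Fin n) Qα mu) = 0 := by
    have := congrArg (fun f : SymHom n N => coeff d (f : MvPolynomial (Fin n) Qα)) hg
    simpa [pElt, coeff_sum] using this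
  rw [Finset.sum_eq_single lam] at hg'
  · rcases mul_eq_zero.mp hg' with h1 | h1
    · exact (Finset.mem_filter.mp hlam).2 h1
    · exact coeff_prod_psum lam.parts (fun a ha => lam.parts_pos ha) d hd h1
  · intro mu _ hmu
    by_contra hc
    have hgm := left_ne_zero_of_mul hc
    have h1 := vals_of_coeff_ne mu.parts (fun a ha => mu.parts_pos ha) d
      (right_ne_zero_of_mul hc)
    have h2 := hmax mu (by simpa using hgm)
    rw [hd] at h1
    exact hmu (Nat.Partition.ext (h1.2 (le_antisymm h1.1 h2)).symm)
  · simp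

/-- Two monomials with the same multiset of nonzero exponents differ by a permutation of the
variables. -/
lemma exists_perm {n : ℕ} (d e : Fin n →₀ ℕ) (h : vals d = vals e) :
    ∃ σ : Equiv.Perm (Fin n), d.mapDomain σ = e := by
  classical
  have hfib : ∀ c : ℕ, Fintype.card {i // d i = c} = Fintype.card {i // e i = c} := by
    have hpos : ∀ c : ℕ, c ≠ 0 → ∀ f : Fin n →₀ ℕ,
        Fintype.card {i // f i = c} = (vals f).count c := by
      intro c hc f
      rw [Fintype.card_subtype, vals, Multiset.count_map, ← Finset.filter_val, Finset.card_val]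
      congr 1
      ext i
      simp only [Finset.mem_filter, Finset.mem_univ, true_and, Finsupp.mem_support_iff]
      constructor
      · intro hi; exact ⟨by rw [hi]; exact hc, hi.symm⟩
      · intro hi; exact hi.2.symm
    have hzero : ∀ f : Fin n →₀ ℕ, Fintype.card {i // f i = 0} = n - (vals f).card := by
      intro f
      have : (Finset.univ.filter fun i => f i = 0) = f.supportᶜ := by
        ext i; simp
      rw [Fintype.card_subtype, this, Finset.card_compl, card_vals, Fintype.card_fin]
    intro c
    by_cases hc : c = 0
    · subst hc; rw [hzero, hzero, h]
    · rw [hpos c hc, hpos c hc, h]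
  let τ : ∀ c : ℕ, {i // d i = c} ≃ {i // e i = c} := fun c => Fintype.equivOfCardEq (hfib c)
  let σ : Equiv.Perm (Fin n) :=
    (Equiv.sigmaFiberEquiv d).symm.trans
      ((Equiv.sigmaCongrRight τ).trans (Equiv.sigmaFiberEquiv e))
  have hσ : ∀ i, e (σ i) = d i := fun i => (τ (d i) ⟨i, rfl⟩).2
  refine ⟨σ, ?_⟩
  ext j
  obtain ⟨i, rfl⟩ := σ.surjective j
  rw [Finsupp.mapDomain_apply σ.injective, hσ]

/-- Chosen monomial with exponents the parts of `lam`. -/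
noncomputable def expo {n N : ℕ} (h : N ≤ n) (lam : N.Partition) : Fin n →₀ ℕ :=
  (exists_vals (n := n) lam.parts (fun _ ha => lam.parts_pos ha)
    ((card_parts_le lam).trans h)).choose

lemma vals_expo {n N : ℕ} (h : N ≤ n) (lam : N.Partition) : vals (expo h lam) = lam.parts :=
  (exists_vals (n := n) lam.parts (fun _ ha => lam.parts_pos ha)
    ((card_parts_le lam).trans h)).choose_spec

/-- Coefficients at the chosen monomials. -/
noncomputable def coeffMap {n N : ℕ} (h : N ≤ n) : SymHom n N →ₗ[Qα] (N.Partition → Qα) :=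
  LinearMap.pi fun lam => (lcoeff Qα (expo h lam)).comp (SymHom n N).subtype

lemma coeffMap_injective {n N : ℕ} (h : N ≤ n) :
    Function.Injective (coeffMap (n := n) (N := N) h) := by
  rw [← LinearMap.ker_eq_bot, LinearMap.ker_eq_bot']
  rintro ⟨f, hsym, hhom⟩ hf
  have hsym' : f.IsSymmetric := hsym
  have hhom' : f.IsHomogeneous N := hhom
  apply Subtype.ext
  change f = 0
  ext d
  rw [coeff_zero]
  by_contra hd
  have hdeg : d.degree = N := by
    have := hhom' hd
    rwa [Finsupp.degree_eq_weight_one]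
  let mu : N.Partition :=
    { parts := vals d
      parts_pos := by
        intro i hi
        obtain ⟨j, hj, rfl⟩ := Multiset.mem_map.mp hi
        exact Nat.pos_of_ne_zero (Finsupp.mem_support_iff.mp hj)
      parts_sum := by rw [vals_sum, hdeg] }
  obtain ⟨σ, hσ⟩ := exists_perm d (expo h mu) (vals_expo h mu).symm
  have h1 : coeff (expo h mu) f = 0 := congrFun hf mu
  have h2 := coeff_rename_mapDomain σ σ.injective f d
  rw [hsym' σ, hσ, h1] at h2
  exact hd h2.symm

lemma card_eq_finrank {n N : ℕ} (h : N ≤ n) :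
    Fintype.card N.Partition = Module.finrank Qα (SymHom n N) := by
  have : Module.Finite Qα (SymHom n N) := Module.Finite.of_injective _ (coeffMap_injective h)
  apply le_antisymm
  · exact (pElt_linearIndependent h).fintype_card_le_finrank
  · have := LinearMap.finrank_le_finrank_of_injective (coeffMap_injective h)
    simpa using this

/-- The power sum basis `(p_λ)`, `|λ| = N`, of the degree `N` component of `Λ_n ⊗ ℚ(α)`,
for `n ≥ N`. -/
noncomputable def powerSumBasis {n N : ℕ} (h : N ≤ n) :
    Module.Basis N.Partition Qα (SymHom n N) :=
  haveI : Module.Finite Qα (SymHom n N) := Module.Finite.of_injective _ (coeffMap_injective h)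
  Module.Basis.mk (pElt_linearIndependent h)
    ((pElt_linearIndependent h).span_eq_top_of_card_eq_finrank'
      (card_eq_finrank h)).ge

lemma powerSumBasis_apply {n N : ℕ} (h : N ≤ n) (lam : N.Partition) :
    (powerSumBasis h lam : MvPolynomial (Fin n) Qα) = psumPart (Fin n) Qα lam := by
  simp [powerSumBasis, pElt]

/-! ### The scalar product and the Jack polynomials -/

/-- The scalar product with `⟨p_λ, p_μ⟩ = δ_{λμ} z_λ α^{ℓ(λ)}`. -/
noncomputable def jackForm {n N : ℕ} (h : N ≤ n) : LinearMap.BilinForm Qα (SymHom n N) :=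
  Matrix.toBilin (powerSumBasis h) (Matrix.diagonal fun lam => (zee lam : Qα) * α ^ len lam)

lemma jackForm_powerSum {n N : ℕ} (h : N ≤ n) (lam mu : N.Partition) :
    jackForm h (pElt n lam) (pElt n mu) =
      if lam = mu then (zee lam : Qα) * α ^ len lam else 0 := by
  have hb : ∀ nu : N.Partition, pElt n nu = powerSumBasis h nu := fun nu => by
    simp [powerSumBasis]
  rw [hb, hb, jackForm, ← LinearMap.BilinForm.toMatrix_apply (powerSumBasis h),
    LinearMap.BilinForm.toMatrix_toBilin, Matrix.diagonal_apply]

open Classical in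
/-- `(J_λ)`, `|λ| = N`, is the family of Jack polynomials in `n ≥ N` variables and `v` is the
matrix of its coefficients in the basis of symmetric monomials `m_μ`. -/
structure IsJackFamily {n N : ℕ} (h : N ≤ n) (J : N.Partition → SymHom n N)
    (v : N.Partition → N.Partition → Qα) : Prop where
  orthogonal : ∀ lam mu, lam ≠ mu → jackForm h (J lam) (J mu) = 0
  expansion : ∀ lam, (J lam : MvPolynomial (Fin n) Qα) =
    ∑ mu : N.Partition with DomLE mu lam, v lam mu • msymm (Fin n) Qα mu
  normalized : ∀ lam, v lam (onePart N) = (N.factorial : Qα)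

end JackPoly

/-!
The argument is that of Knop and Sahi. The joint eigenfunctions of the Cherednik operators `ξ_i`,
the nonsymmetric Jack polynomials, are built up one box at a time. The operator
`f ↦ x_n f(x_n, x_1, …, x_{n-1})` adds a box and preserves joint eigenfunctions; the intertwiners
that then move the new box to its place involve denominators, but for a composition with trailing
zeros these cancel, and the whole step becomes a combination over `ℤ[α]` of the operators
`f ↦ x_i f(x_i, x_1, …, x_{i-1}, x_{i+1}, …)`. Symmetrizing over the placements of the nonzero
entries, instead of over all permutations, avoids dividing by the number of permutations of the
zeros and gives symmetric eigenfunctions of `∑ ξ_i²` with coefficients in `ℤ[α]` and the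
normalization of `J_λ`.

These are triangular because `ξ_i` is `α x_i ∂_i`, diagonal in the monomials, up to terms that do
not grow with `α` and respect dominance: a coefficient at a monomial not dominated by `λ` would have
degree in `α` smaller than any bound. Written in the power sums, `∑ ξ_i²` is self-adjoint for the
Jack form, and its eigenvalues separate comparable partitions. Since the form is anisotropic (it is
positive definite at positive rational values of `α`), a triangular, normalized family that is
orthogonal on comparable partitions must be `(J_λ)`.
-/

namespace JackPoly

open MvPolynomial

section Permutation

variable {ι R : Type*} [CommSemiring R]

lemma rename_perm_mul (σ τ : Equiv.Perm ι) (f : MvPolynomial ι R) :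
    rename (σ * τ) f = rename σ (rename τ f) := by
  rw [rename_rename, Equiv.Perm.coe_mul]

lemma rename_perm_one (f : MvPolynomial ι R) : rename (1 : Equiv.Perm ι) f = f :=
  rename_id_apply f

lemma rename_swap_rename_swap [DecidableEq ι] (i j : ι) (f : MvPolynomial ι R) :
    rename (Equiv.swap i j) (rename (Equiv.swap i j) f) = f := by
  rw [← rename_perm_mul, Equiv.swap_mul_self, rename_perm_one]

lemma coeff_rename_perm (σ : Equiv.Perm ι) (d : ι →₀ ℕ) (f : MvPolynomial ι R) :
    coeff d (rename σ f) = coeff (Finsupp.equivMapDomain σ.symm d) f := by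
  have h := coeff_rename_mapDomain σ σ.injective f (Finsupp.equivMapDomain σ.symm d)
  rw [← Finsupp.equivMapDomain_eq_mapDomain, ← Finsupp.equivMapDomain_trans] at h
  simpa using h

end Permutation

section DividedDifference

variable {ι R : Type*} [CommRing R]

lemma X_sub_X_mul_left_cancel {i j : ι} (h : i ≠ j) {f g : MvPolynomial ι R}
    (hfg : (X i - X j) * f = (X i - X j) * g) : f = g := by
  classical
  -- The automorphism `x_i ↦ x_i + x_j` turns the factor `x_i - x_j` into the regular element `x_i`.
  let φ : MvPolynomial ι R →ₐ[R] MvPolynomial ι R := aeval (Function.update X i (X i + X j))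
  let ψ : MvPolynomial ι R →ₐ[R] MvPolynomial ι R := aeval (Function.update X i (X i - X j))
  have hψφ : ψ.comp φ = AlgHom.id R _ := by
    ext1 k
    rcases eq_or_ne k i with rfl | hk
    · simp [φ, ψ, h.symm]
    · simp [φ, ψ, hk]
  have hφ : φ f = φ g := by simpa [φ, h.symm] using congrArg φ hfg
  simpa using (DFunLike.congr_fun hψφ f).symm.trans
    ((congrArg ψ hφ).trans (DFunLike.congr_fun hψφ g))

lemma eq_of_X_sub_X_mul_eq {i j : ι} {f g : MvPolynomial ι R}
    (h : (X i - X j) * f = (X i - X j) * g) (hf : i = j → f = 0) (hg : i = j → g = 0) :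
    f = g := by
  rcases eq_or_ne i j with hij | hij
  · rw [hf hij, hg hij]
  · exact X_sub_X_mul_left_cancel hij h

variable [DecidableEq ι]

lemma X_sub_X_dvd_sub_rename_swap (i j : ι) (f : MvPolynomial ι R) :
    X i - X j ∣ f - rename (Equiv.swap i j) f := by
  rw [← Ideal.mem_span_singleton, ← Ideal.Quotient.eq]
  set I : Ideal (MvPolynomial ι R) := Ideal.span {X i - X j}
  have hij : Ideal.Quotient.mk I (X i) = Ideal.Quotient.mk I (X j) :=
    Ideal.Quotient.eq.mpr (Ideal.mem_span_singleton_self _)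
  have hswap : Ideal.Quotient.mkₐ R I =
      (Ideal.Quotient.mkₐ R I).comp (rename (Equiv.swap i j)) := by
    ext k
    simp only [Ideal.Quotient.mkₐ_eq_mk, AlgHom.coe_comp, Function.comp_apply, rename_X]
    rcases eq_or_ne k i with rfl | hi
    · rw [Equiv.swap_apply_left, hij]
    · rcases eq_or_ne k j with rfl | hj
      · rw [Equiv.swap_apply_right, hij]
      · rw [Equiv.swap_apply_of_ne_of_ne hi hj]
  exact DFunLike.congr_fun hswap f

lemma exists_X_sub_X_mul_eq (i j : ι) (f : MvPolynomial ι R) :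
    ∃ g, (X i - X j) * g = f - rename (Equiv.swap i j) f ∧ (i = j → g = 0) := by
  rcases eq_or_ne i j with rfl | h
  · exact ⟨0, by simp⟩
  · obtain ⟨g, hg⟩ := X_sub_X_dvd_sub_rename_swap i j f
    exact ⟨g, hg.symm, fun hij => absurd hij h⟩

/-- The divided difference operator `f ↦ (f - s_{ij} f) / (x_i - x_j)`, where `s_{ij}` exchanges
`x_i` and `x_j`. It is set to be `0` for `i = j`. -/
noncomputable def divDiff (i j : ι) : MvPolynomial ι R →ₗ[R] MvPolynomial ι R where
  toFun f := (exists_X_sub_X_mul_eq i j f).choose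
  map_add' f g := by
    have hf := (exists_X_sub_X_mul_eq i j f).choose_spec
    have hg := (exists_X_sub_X_mul_eq i j g).choose_spec
    have hfg := (exists_X_sub_X_mul_eq i j (f + g)).choose_spec
    refine eq_of_X_sub_X_mul_eq ?_ hfg.2 fun h => by rw [hf.2 h, hg.2 h, add_zero]
    rw [hfg.1, mul_add, hf.1, hg.1, map_add]
    ring
  map_smul' c f := by
    have hf := (exists_X_sub_X_mul_eq i j f).choose_spec
    have hcf := (exists_X_sub_X_mul_eq i j (c • f)).choose_spec
    refine eq_of_X_sub_X_mul_eq ?_ hcf.2 fun h => by rw [hf.2 h, smul_zero]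
    rw [hcf.1, RingHom.id_apply, mul_smul_comm, hf.1, map_smul, smul_sub]

lemma X_sub_X_mul_divDiff (i j : ι) (f : MvPolynomial ι R) :
    (X i - X j) * divDiff i j f = f - rename (Equiv.swap i j) f :=
  (exists_X_sub_X_mul_eq i j f).choose_spec.1

@[simp] lemma divDiff_self (i : ι) (f : MvPolynomial ι R) : divDiff i i f = 0 :=
  (exists_X_sub_X_mul_eq i i f).choose_spec.2 rfl

lemma divDiff_eq_of_X_sub_X_mul_eq {i j : ι} (h : i ≠ j) {f g : MvPolynomial ι R}
    (hg : (X i - X j) * g = f - rename (Equiv.swap i j) f) : divDiff i j f = g :=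
  X_sub_X_mul_left_cancel h ((X_sub_X_mul_divDiff i j f).trans hg.symm)

lemma divDiff_swap (i j : ι) (f : MvPolynomial ι R) : divDiff j i f = -divDiff i j f := by
  rcases eq_or_ne i j with rfl | h
  · simp
  · refine divDiff_eq_of_X_sub_X_mul_eq h.symm ?_
    rw [Equiv.swap_comm]
    linear_combination X_sub_X_mul_divDiff i j f

lemma divDiff_eq_zero (i j : ι) {f : MvPolynomial ι R} (h : rename (Equiv.swap i j) f = f) :
    divDiff i j f = 0 := by
  rcases eq_or_ne i j with rfl | hij
  · simp
  · exact divDiff_eq_of_X_sub_X_mul_eq hij (by rw [h, mul_zero, sub_self])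

lemma rename_divDiff (σ : Equiv.Perm ι) (i j : ι) (f : MvPolynomial ι R) :
    rename σ (divDiff i j f) = divDiff (σ i) (σ j) (rename σ f) := by
  rcases eq_or_ne i j with rfl | h
  · simp
  · refine (divDiff_eq_of_X_sub_X_mul_eq (σ.injective.ne h) ?_).symm
    have hσ := congrArg (rename σ) (X_sub_X_mul_divDiff i j f)
    rw [map_mul, map_sub, map_sub, rename_X, rename_X] at hσ
    rw [hσ, ← rename_perm_mul, ← rename_perm_mul, Equiv.swap_apply_apply, inv_mul_cancel_right]

lemma map_divDiff {S : Type*} [CommRing S] (φ : R →+* S) (i j : ι) (f : MvPolynomial ι R) :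
    map φ (divDiff i j f) = divDiff i j (map φ f) := by
  rcases eq_or_ne i j with rfl | h
  · simp
  · refine (divDiff_eq_of_X_sub_X_mul_eq h ?_).symm
    simpa [map_rename] using congrArg (map φ) (X_sub_X_mul_divDiff i j f)

lemma divDiff_mul_of_rename_swap_eq {i j : ι} {s : MvPolynomial ι R}
    (hs : rename (Equiv.swap i j) s = s) (f : MvPolynomial ι R) :
    divDiff i j (s * f) = s * divDiff i j f := by
  rcases eq_or_ne i j with rfl | h
  · simp
  · refine divDiff_eq_of_X_sub_X_mul_eq h ?_
    rw [map_mul, hs]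
    linear_combination s * X_sub_X_mul_divDiff i j f

lemma divDiff_X_mul_of_ne {i j k : ι} (hi : k ≠ i) (hj : k ≠ j) (f : MvPolynomial ι R) :
    divDiff i j (X k * f) = X k * divDiff i j f :=
  divDiff_mul_of_rename_swap_eq (by rw [rename_X, Equiv.swap_apply_of_ne_of_ne hi hj]) f

lemma divDiff_X_right_mul {i j : ι} (h : i ≠ j) (f : MvPolynomial ι R) :
    divDiff i j (X j * f) = X i * divDiff i j f - f := by
  refine divDiff_eq_of_X_sub_X_mul_eq h ?_
  rw [map_mul, rename_X, Equiv.swap_apply_right]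
  linear_combination X i * X_sub_X_mul_divDiff i j f

lemma divDiff_X_left_mul {i j : ι} (h : i ≠ j) (f : MvPolynomial ι R) :
    divDiff i j (X i * f) = X j * divDiff i j f + f := by
  refine divDiff_eq_of_X_sub_X_mul_eq h ?_
  rw [map_mul, rename_X, Equiv.swap_apply_left]
  linear_combination X j * X_sub_X_mul_divDiff i j f

end DividedDifference

section Euler

variable {ι R : Type*} [CommRing R]

/-- The Euler operator `x_i ∂_i`. -/
noncomputable def euler (i : ι) : MvPolynomial ι R →ₗ[R] MvPolynomial ι R :=
  LinearMap.mulLeft R (X i) ∘ₗ (pderiv i).toLinearMap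

lemma euler_apply (i : ι) (f : MvPolynomial ι R) : euler i f = X i * pderiv i f := rfl

lemma euler_mul (i : ι) (f g : MvPolynomial ι R) :
    euler i (f * g) = euler i f * g + f * euler i g := by
  simp only [euler_apply, pderiv_mul]
  ring

lemma rename_euler (σ : Equiv.Perm ι) (i : ι) (f : MvPolynomial ι R) :
    rename σ (euler i f) = euler (σ i) (rename σ f) := by
  rw [euler_apply, euler_apply, map_mul, rename_X, pderiv_rename σ.injective]

lemma euler_X_self (i : ι) : euler i (X i : MvPolynomial ι R) = X i := by
  rw [euler_apply, pderiv_X_self, mul_one]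

lemma euler_X_of_ne {i j : ι} (h : j ≠ i) : euler i (X j : MvPolynomial ι R) = 0 := by
  rw [euler_apply, pderiv_X_of_ne h, mul_zero]

lemma map_euler {S : Type*} [CommRing S] (φ : R →+* S) (i : ι) (f : MvPolynomial ι R) :
    map φ (euler i f) = euler i (map φ f) := by
  rw [euler_apply, euler_apply, map_mul, map_X, pderiv_map]

lemma coeff_euler (i : ι) (f : MvPolynomial ι R) (d : ι →₀ ℕ) :
    coeff d (euler i f) = d i * coeff d f := by
  classical
  induction f using MvPolynomial.induction_on' with
  | monomial u c =>
    rw [euler_apply, X_mul_pderiv_monomial, coeff_smul, coeff_monomial, nsmul_eq_mul]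
    split_ifs with h
    · rw [h]
    · rw [mul_zero, mul_zero]
  | add p q hp hq => rw [map_add, coeff_add, coeff_add, hp, hq, mul_add]

end Euler

section Cherednik

variable {n : ℕ} {R : Type*} [CommRing R] (a : R)

/-- The Cherednik operator
`ξ_i = a x_i ∂_i + ∑_{j < i} x_i N_{ij} + ∑_{j > i} x_j N_{ij} - i` of the parameter `a`, where
`N_{ij}` are the divided differences and the variables are numbered from `0`. -/
noncomputable def cherednik (i : Fin n) : MvPolynomial (Fin n) R →ₗ[R] MvPolynomial (Fin n) R :=
  a • euler i + ∑ j, LinearMap.mulLeft R (X (max i j)) ∘ₗ divDiff i j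
    - ((i : ℕ) : R) • LinearMap.id

lemma cherednik_apply (i : Fin n) (f : MvPolynomial (Fin n) R) :
    cherednik a i f = C a * euler i f + ∑ j, X (max i j) * divDiff i j f
      - ((i : ℕ) : MvPolynomial (Fin n) R) * f := by
  simp [cherednik, smul_eq_C_mul]

lemma map_cherednik {S : Type*} [CommRing S] (φ : R →+* S) (i : Fin n)
    (f : MvPolynomial (Fin n) R) : map φ (cherednik a i f) = cherednik (φ a) i (map φ f) := by
  simp [cherednik_apply, map_euler, map_divDiff]

lemma cherednik_C_mul (i : Fin n) (c : R) (f : MvPolynomial (Fin n) R) :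
    cherednik a i (C c * f) = C c * cherednik a i f := by
  rw [← smul_eq_C_mul, ← smul_eq_C_mul, map_smul]

lemma rename_cherednik (σ : Equiv.Perm (Fin n)) (i : Fin n) (f : MvPolynomial (Fin n) R) :
    rename σ (cherednik a i f) = C a * euler (σ i) (rename σ f)
      + ∑ j, X (σ (max i j)) * divDiff (σ i) (σ j) (rename σ f)
      - ((i : ℕ) : MvPolynomial (Fin n) R) * rename σ f := by
  rw [cherednik_apply, map_sub, map_add, map_mul, map_mul, rename_C, rename_euler, map_sum,
    map_natCast]
  simp only [map_mul, rename_divDiff, rename_X]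

lemma swap_max_of_ne {k k' i : Fin n} (hk : (k' : ℕ) = k + 1) (hi : i ≠ k) (hi' : i ≠ k')
    (j : Fin n) : Equiv.swap k k' (max i j) = max i (Equiv.swap k k' j) := by
  simp only [Equiv.swap_apply_def, Fin.ext_iff] at *
  grind

lemma rename_swap_cherednik_of_ne {k k' i : Fin n} (hk : (k' : ℕ) = k + 1) (hi : i ≠ k)
    (hi' : i ≠ k') (f : MvPolynomial (Fin n) R) :
    rename (Equiv.swap k k') (cherednik a i f) = cherednik a i (rename (Equiv.swap k k') f) := by
  rw [rename_cherednik, cherednik_apply, Equiv.swap_apply_of_ne_of_ne hi hi']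
  congr 2
  exact Fintype.sum_equiv (Equiv.swap k k') _ _ fun j => by rw [swap_max_of_ne hk hi hi']

lemma sum_X_swap_max_mul_divDiff {k k' : Fin n} (hk : (k' : ℕ) = k + 1)
    (g : MvPolynomial (Fin n) R) :
    ∑ j, X (Equiv.swap k k' (max k j)) * divDiff k' (Equiv.swap k k' j) g
      = ∑ j, X (max k' j) * divDiff k' j g + (rename (Equiv.swap k k') g - g) := by
  have hne : k' ≠ k := fun h => by omega
  have hle : k ≤ k' := by omega
  calc ∑ j, X (Equiv.swap k k' (max k j)) * divDiff k' (Equiv.swap k k' j) g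
      = ∑ j, (X (max k' j) * divDiff k' j g
          + if j = k then rename (Equiv.swap k k') g - g else 0) := by
        refine Fintype.sum_equiv (Equiv.swap k k') _ _ fun j => ?_
        rcases eq_or_ne j k with rfl | hj
        · simp only [Equiv.swap_apply_left, divDiff_self, if_neg hne, mul_zero, add_zero]
        · rcases eq_or_ne j k' with rfl | hj'
          · rw [max_eq_right hle, Equiv.swap_apply_right, max_eq_left hle, if_pos rfl]
            have hspec := X_sub_X_mul_divDiff j k g
            rw [Equiv.swap_comm] at hspec
            linear_combination -hspec
          · rw [max_comm, swap_max_of_ne hk hj hj', Equiv.swap_apply_left, max_comm,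
              Equiv.swap_apply_of_ne_of_ne hj hj', if_neg hj, add_zero]
    _ = _ := by
        rw [Finset.sum_add_distrib, Finset.sum_ite_eq' Finset.univ k, if_pos (Finset.mem_univ k)]

lemma rename_swap_cherednik_left {k k' : Fin n} (hk : (k' : ℕ) = k + 1)
    (f : MvPolynomial (Fin n) R) :
    rename (Equiv.swap k k') (cherednik a k f)
      = cherednik a k' (rename (Equiv.swap k k') f) + f := by
  rw [rename_cherednik, cherednik_apply, Equiv.swap_apply_left, sum_X_swap_max_mul_divDiff hk,
    rename_swap_rename_swap, hk, Nat.cast_add_one]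
  ring

lemma rename_swap_cherednik_right {k k' : Fin n} (hk : (k' : ℕ) = k + 1)
    (f : MvPolynomial (Fin n) R) :
    rename (Equiv.swap k k') (cherednik a k' f)
      = cherednik a k (rename (Equiv.swap k k') f) - f := by
  have hleft := congrArg (rename (Equiv.swap k k'))
    (rename_swap_cherednik_left a hk (rename (Equiv.swap k k') f))
  rw [map_add, rename_swap_rename_swap, rename_swap_rename_swap] at hleft
  rw [hleft, add_sub_cancel_right]

/-- The sum of the squares of the Cherednik operators, the simplest symmetric function of them that
separates the Jack polynomials. -/
noncomputable def cherednikSq : MvPolynomial (Fin n) R →ₗ[R] MvPolynomial (Fin n) R :=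
  ∑ i, cherednik a i ∘ₗ cherednik a i

lemma cherednikSq_apply (f : MvPolynomial (Fin n) R) :
    cherednikSq a f = ∑ i, cherednik a i (cherednik a i f) := by
  simp [cherednikSq]

lemma map_cherednikSq {S : Type*} [CommRing S] (φ : R →+* S) (f : MvPolynomial (Fin n) R) :
    map φ (cherednikSq a f) = cherednikSq (φ a) (map φ f) := by
  simp [cherednikSq_apply, map_cherednik]

lemma rename_swap_cherednikSq {k k' : Fin n} (hk : (k' : ℕ) = k + 1)
    (f : MvPolynomial (Fin n) R) :
    rename (Equiv.swap k k') (cherednikSq a f)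
      = cherednikSq a (rename (Equiv.swap k k') f) := by
  have hne : k ≠ k' := fun h => by omega
  have sum_split (F : Fin n → MvPolynomial (Fin n) R) :
      ∑ i, F i = (F k + F k') + ∑ i ∈ ({k, k'} : Finset (Fin n))ᶜ, F i := by
    rw [← Finset.sum_pair hne, Finset.sum_add_sum_compl]
  rw [cherednikSq_apply, cherednikSq_apply, sum_split, sum_split, map_add, map_add, map_sum]
  congr 1
  · simp only [rename_swap_cherednik_left a hk, rename_swap_cherednik_right a hk, map_add, map_sub]
    ring
  · refine Finset.sum_congr rfl fun i hi => ?_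
    simp only [Finset.mem_compl, Finset.mem_insert, Finset.mem_singleton, not_or] at hi
    rw [rename_swap_cherednik_of_ne a hk hi.1 hi.2, rename_swap_cherednik_of_ne a hk hi.1 hi.2]

lemma rename_cherednikSq (σ : Equiv.Perm (Fin n)) (f : MvPolynomial (Fin n) R) :
    rename σ (cherednikSq a f) = cherednikSq a (rename σ f) := by
  cases n with
  | zero => rw [Subsingleton.elim σ 1, rename_perm_one, rename_perm_one]
  | succ n =>
    have hσ : σ ∈ Submonoid.closure (Set.range fun i : Fin n ↦ Equiv.swap i.castSucc i.succ) := by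
      rw [Equiv.Perm.mclosure_swap_castSucc_succ]
      exact Submonoid.mem_top σ
    induction hσ using Submonoid.closure_induction generalizing f with
    | mem x hx =>
      obtain ⟨i, rfl⟩ := hx
      exact rename_swap_cherednikSq a (by simp) f
    | one => rw [rename_perm_one, rename_perm_one]
    | mul x y _ _ hx hy => rw [rename_perm_mul, rename_perm_mul, hy, hx]

end Cherednik

section SortRank

variable {n : ℕ}

/-- The number of entries which precede the `i`-th one when the entries of the composition `η` are
sorted decreasingly, ties being broken by position. The eigenvalues of the Cherednik operators on
the nonsymmetric Jack polynomial of index `η` are `a η_i - sortRank η i`. -/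
def sortRank (η : Fin n → ℕ) (i : Fin n) : ℕ :=
  (Finset.univ.filter fun j => η i < η j ∨ (η j = η i ∧ j < i)).card

lemma sortRank_zero (i : Fin n) : sortRank 0 i = i := by
  simp [sortRank, Finset.filter_gt_eq_Iio]

lemma sortRank_apply_perm {η η' : Fin n → ℕ} (σ : Equiv.Perm (Fin n)) (i : Fin n)
    (h : ∀ j, (η' (σ i) < η' (σ j) ∨ (η' (σ j) = η' (σ i) ∧ σ j < σ i)) ↔
      (η i < η j ∨ (η j = η i ∧ j < i))) : sortRank η' (σ i) = sortRank η i := by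
  refine (Finset.card_equiv σ fun j => ?_).symm
  simp only [Finset.mem_filter, Finset.mem_univ, true_and]
  exact (h j).symm

lemma swap_lt_swap_iff {k k' i j : Fin n} (hk : (k' : ℕ) = k + 1) (h : i = k → j ≠ k')
    (h' : i = k' → j ≠ k) : Equiv.swap k k' j < Equiv.swap k k' i ↔ j < i := by
  simp only [Equiv.swap_apply_def, Fin.ext_iff, Fin.lt_def, ne_eq] at *
  grind

lemma sortRank_comp_swap {k k' : Fin n} (hk : (k' : ℕ) = k + 1) {η : Fin n → ℕ}
    (hη : η k ≠ η k') (i : Fin n) :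
    sortRank (η ∘ Equiv.swap k k') (Equiv.swap k k' i) = sortRank η i := by
  refine sortRank_apply_perm _ _ fun j => ?_
  simp only [Function.comp_apply, Equiv.swap_apply_self]
  refine or_congr_right (and_congr_right fun hji => swap_lt_swap_iff hk ?_ ?_) <;> grind

end SortRank

section Shift

variable {n : ℕ}

lemma cycleRange_last_symm_succ (i : Fin n) :
    (Fin.last n).cycleRange.symm i.succ = i.castSucc := by
  rw [Fin.cycleRange_symm_succ, Fin.succAbove_last]

lemma cycleRange_symm_succ_of_castSucc_lt {k : Fin (n + 1)} {j : Fin n} (h : j.castSucc < k) :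
    k.cycleRange.symm j.succ = j.castSucc := by
  rw [Fin.cycleRange_symm_succ, Fin.succAbove_of_castSucc_lt _ _ h]

lemma cycleRange_castSucc (k : Fin n) :
    k.castSucc.cycleRange = k.succ.cycleRange * Equiv.swap k.castSucc k.succ := by
  ext j
  have hlt : k.castSucc < k.succ := Fin.castSucc_lt_succ
  rcases lt_trichotomy j k.castSucc with h | rfl | h
  · simp [Fin.cycleRange_of_lt h, Fin.cycleRange_of_lt (h.trans hlt),
      Equiv.swap_apply_of_ne_of_ne h.ne (h.trans hlt).ne]
  · simp
  · rcases eq_or_ne j k.succ with rfl | hj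
    · simp [Fin.cycleRange_of_gt h, Fin.cycleRange_of_lt hlt]
    · have hj' : k.succ < j := lt_of_le_of_ne (Fin.castSucc_lt_iff_succ_le.mp h) hj.symm
      simp [Fin.cycleRange_of_gt h, Fin.cycleRange_of_gt hj',
        Equiv.swap_apply_of_ne_of_ne h.ne' hj]

/-- The composition `(η_1, …, η_k, η_0 + 1, η_{k+1}, …)`. -/
def shift (k : Fin (n + 1)) (η : Fin (n + 1) → ℕ) (i : Fin (n + 1)) : ℕ :=
  η (k.cycleRange i) + if i = k then 1 else 0

lemma shift_self (k : Fin (n + 1)) (η : Fin (n + 1) → ℕ) : shift k η k = η 0 + 1 := by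
  simp [shift]

lemma shift_of_lt {k j : Fin (n + 1)} (h : k < j) (η : Fin (n + 1) → ℕ) :
    shift k η j = η j := by
  simp [shift, Fin.cycleRange_of_gt h, h.ne']

lemma shift_castSucc_of_lt {k : Fin (n + 1)} {j : Fin n} (h : j.castSucc < k)
    (η : Fin (n + 1) → ℕ) : shift k η j.castSucc = η j.succ := by
  simp [shift, h.ne, Fin.cycleRange_of_lt h]

lemma shift_castSucc (k : Fin n) (η : Fin (n + 1) → ℕ) :
    shift k.castSucc η = shift k.succ η ∘ Equiv.swap k.castSucc k.succ := by
  ext j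
  simp only [shift, Function.comp_apply, cycleRange_castSucc, Equiv.Perm.mul_apply,
    Equiv.swap_apply_eq_iff, Equiv.swap_apply_right]

lemma exists_shift_eq (k : Fin (n + 1)) {η : Fin (n + 1) → ℕ} (h : η k ≠ 0) :
    ∃ η', shift k η' = η := by
  refine ⟨fun i => η (k.cycleRange.symm i) - if i = 0 then 1 else 0, funext fun j => ?_⟩
  rcases eq_or_ne j k with rfl | hj
  · simpa [shift] using Nat.succ_pred_eq_of_ne_zero h
  · have h0 : k.cycleRange j ≠ 0 := by
      rwa [← Fin.cycleRange_self k, k.cycleRange.injective.ne_iff]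
    simp [shift, hj, h0]

lemma sum_shift (k : Fin (n + 1)) (η : Fin (n + 1) → ℕ) :
    ∑ i, shift k η i = ∑ i, η i + 1 := by
  simp only [shift, Finset.sum_add_distrib, Finset.sum_ite_eq', Finset.mem_univ, if_true]
  rw [Equiv.sum_comp k.cycleRange η]

lemma sortRank_shift_last (η : Fin (n + 1) → ℕ) (i : Fin (n + 1)) :
    sortRank (shift (Fin.last n) η) ((Fin.last n).cycleRange.symm i) = sortRank η i := by
  refine sortRank_apply_perm _ _ fun j => ?_
  induction i using Fin.cases <;> induction j using Fin.cases <;>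
    simp only [Fin.cycleRange_symm_zero, cycleRange_last_symm_succ, shift_self,
      shift_castSucc_of_lt (Fin.castSucc_lt_last _), Fin.lt_def, Fin.val_castSucc, Fin.val_last,
      Fin.val_succ, Fin.val_zero] <;>
    omega

lemma shift_succ_ne {η : Fin (n + 1) → ℕ} {k : Fin n} (h : η k.succ = 0) :
    shift k.succ η k.castSucc ≠ shift k.succ η k.succ := by
  rw [shift_self, shift_castSucc_of_lt Fin.castSucc_lt_succ, h]
  exact (Nat.succ_ne_zero _).symm

lemma sortRank_shift_self {η : Fin (n + 1) → ℕ} {p k : Fin (n + 1)} (hη : ∀ j, p < j → η j = 0)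
    (hk : p ≤ k) : sortRank (shift k η) k = sortRank η 0 := by
  induction k using Fin.reverseInduction with
  | last => simpa only [Fin.cycleRange_symm_zero] using sortRank_shift_last η 0
  | cast k ih =>
    have hlt : p < k.succ := hk.trans_lt Fin.castSucc_lt_succ
    have hswap := sortRank_comp_swap (by simp) (shift_succ_ne (hη _ hlt)) k.succ
    rw [Equiv.swap_apply_right, ← shift_castSucc] at hswap
    rw [hswap, ih hlt.le]

lemma sortRank_shift_succ_castSucc {η : Fin (n + 1) → ℕ} (k : Fin n)
    (hη : ∀ j, k.castSucc < j → η j = 0) : sortRank (shift k.succ η) k.castSucc = k + 1 := by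
  have hlt : k.castSucc < k.succ := Fin.castSucc_lt_succ
  have hfilter : (Finset.univ.filter fun j => shift k.succ η k.castSucc < shift k.succ η j ∨
      (shift k.succ η j = shift k.succ η k.castSucc ∧ j < k.castSucc)) =
      (Finset.Iic k.succ).erase k.castSucc := by
    ext j
    simp only [Finset.mem_filter, Finset.mem_univ, true_and, Finset.mem_erase, Finset.mem_Iic,
      shift_castSucc_of_lt hlt, hη _ hlt]
    rcases lt_trichotomy j k.castSucc with h | rfl | h
    · simp only [h, h.ne, (h.trans hlt).le, and_true, ne_eq, not_false_eq_true, iff_true]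
      exact (Nat.eq_zero_or_pos _).symm
    · simp [shift_castSucc_of_lt hlt, hη _ hlt]
    · rcases eq_or_ne j k.succ with rfl | hj
      · simp [shift_self, hlt.ne']
      · have hj' : k.succ < j := lt_of_le_of_ne (Fin.castSucc_lt_iff_succ_le.mp h) hj.symm
        simp only [shift_of_lt hj', hη _ h, lt_self_iff_false, false_or, h.not_gt,
          hj'.not_ge, and_false]
  rw [sortRank, hfilter, Finset.card_erase_of_mem (Finset.mem_Iic.mpr hlt.le), Fin.card_Iic]
  simp

end Shift

section Creation

variable {n : ℕ} {R : Type*} [CommRing R]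

/-- The operator `f ↦ x_i f(x_i, x_0, …, x_{i-1}, x_{i+1}, …)`. For the last index `i` it maps
joint eigenfunctions of the Cherednik operators to joint eigenfunctions. -/
noncomputable def creation (i : Fin (n + 1)) :
    MvPolynomial (Fin (n + 1)) R →ₗ[R] MvPolynomial (Fin (n + 1)) R :=
  LinearMap.mulLeft R (X i) ∘ₗ (rename i.cycleRange.symm).toLinearMap

lemma creation_apply (i : Fin (n + 1)) (f : MvPolynomial (Fin (n + 1)) R) :
    creation i f = X i * rename i.cycleRange.symm f := rfl

lemma creation_C_mul (i : Fin (n + 1)) (c : R) (f : MvPolynomial (Fin (n + 1)) R) :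
    creation i (C c * f) = C c * creation i f := by
  rw [← smul_eq_C_mul, ← smul_eq_C_mul, map_smul]

lemma cherednik_castSucc_creation_last (a : R) (i : Fin n) (f : MvPolynomial (Fin (n + 1)) R) :
    cherednik a i.castSucc (creation (Fin.last n) f)
      = creation (Fin.last n) (cherednik a i.succ f) := by
  rw [creation_apply, creation_apply, rename_cherednik, cherednik_apply, cycleRange_last_symm_succ]
  set g := rename (Fin.last n).cycleRange.symm f
  have hne : i.castSucc ≠ Fin.last n := (Fin.castSucc_lt_last i).ne
  have hterm (j : Fin n) :
      X (max i.castSucc j.castSucc) * divDiff i.castSucc j.castSucc (X (Fin.last n) * g)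
        = X (Fin.last n) * (X ((Fin.last n).cycleRange.symm (max i.succ j.succ)) *
          divDiff i.castSucc ((Fin.last n).cycleRange.symm j.succ) g) := by
    rw [← Fin.strictMono_succ.monotone.map_max, ← Fin.strictMono_castSucc.monotone.map_max,
      cycleRange_last_symm_succ, cycleRange_last_symm_succ,
      divDiff_X_mul_of_ne hne.symm (Fin.castSucc_lt_last j).ne', mul_left_comm]
  rw [Fin.sum_univ_castSucc, Fin.sum_univ_succ, Fin.cycleRange_symm_zero,
    max_eq_left (Fin.zero_le _), cycleRange_last_symm_succ, max_eq_right (Fin.le_last _),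
    divDiff_X_right_mul hne, euler_mul, euler_X_of_ne hne.symm,
    Finset.sum_congr rfl fun j _ => hterm j, ← Finset.mul_sum, Fin.val_castSucc, Fin.val_succ,
    Nat.cast_add_one]
  ring

lemma cherednik_last_creation_last (a : R) (f : MvPolynomial (Fin (n + 1)) R) :
    cherednik a (Fin.last n) (creation (Fin.last n) f) =
      creation (Fin.last n) (cherednik a 0 f) + C a * creation (Fin.last n) f := by
  rw [creation_apply, creation_apply, rename_cherednik, cherednik_apply, Fin.cycleRange_symm_zero]
  set g := rename (Fin.last n).cycleRange.symm f
  have hterm (j : Fin n) :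
      X (max (Fin.last n) j.castSucc) * divDiff (Fin.last n) j.castSucc (X (Fin.last n) * g)
        = X (Fin.last n) * (X ((Fin.last n).cycleRange.symm (max 0 j.succ)) *
          divDiff (Fin.last n) ((Fin.last n).cycleRange.symm j.succ) g) + X (Fin.last n) * g := by
    rw [max_eq_left (Fin.le_last _), max_eq_right (Fin.zero_le _), cycleRange_last_symm_succ,
      divDiff_X_left_mul (Fin.castSucc_lt_last j).ne', mul_add]
  rw [Fin.sum_univ_castSucc, Fin.sum_univ_succ, Fin.cycleRange_symm_zero, divDiff_self,
    divDiff_self, euler_mul, euler_X_self, Finset.sum_congr rfl fun j _ => hterm j,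
    Finset.sum_add_distrib, ← Finset.mul_sum, Finset.sum_const, Finset.card_univ, Fintype.card_fin,
    nsmul_eq_mul, Fin.val_last, Fin.val_zero, Nat.cast_zero]
  ring

/-- Symmetry of a polynomial in the variables from the `m`-th one on. -/
def IsSymmetricFrom (m : ℕ) (f : MvPolynomial (Fin n) R) : Prop :=
  ∀ σ : Equiv.Perm (Fin n), (∀ j : Fin n, (j : ℕ) < m → σ j = j) → rename σ f = f

lemma IsSymmetricFrom.mono {m m' : ℕ} (h : m ≤ m') {f : MvPolynomial (Fin n) R}
    (hf : IsSymmetricFrom m f) : IsSymmetricFrom m' f :=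
  fun σ hσ => hf σ fun j hj => hσ j (hj.trans_le h)

lemma le_perm_apply {m : ℕ} {σ : Equiv.Perm (Fin n)}
    (hσ : ∀ j : Fin n, (j : ℕ) < m → σ j = j) {i : Fin n} (hi : m ≤ i) : m ≤ σ i := by
  by_contra! h
  have hfix : σ i = i := σ.injective (hσ _ h)
  omega

lemma rename_creation {p : ℕ} {f : MvPolynomial (Fin (n + 1)) R} (hf : IsSymmetricFrom (p + 1) f)
    {σ : Equiv.Perm (Fin (n + 1))} (hσ : ∀ j : Fin (n + 1), (j : ℕ) < p → σ j = j)
    {i : Fin (n + 1)} (hi : p ≤ i) : rename σ (creation i f) = creation (σ i) f := by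
  have hσi : p ≤ σ i := le_perm_apply hσ hi
  have hfix : rename ((σ i).cycleRange * σ * i.cycleRange.symm) f = f := by
    refine hf _ fun j => Fin.cases (by simp) (fun j hj => ?_) j
    have hjp : (j : ℕ) < p := by simpa using hj
    have hj₁ : j.castSucc < i := Fin.lt_def.mpr (hjp.trans_le hi)
    have hj₂ : j.castSucc < σ i := Fin.lt_def.mpr (hjp.trans_le hσi)
    rw [Equiv.Perm.mul_apply, Equiv.Perm.mul_apply, cycleRange_symm_succ_of_castSucc_lt hj₁,
      hσ j.castSucc hjp, ← cycleRange_symm_succ_of_castSucc_lt hj₂, Equiv.apply_symm_apply]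
  rw [creation_apply, creation_apply, map_mul, rename_X, ← rename_perm_mul]
  conv_rhs => rw [← hfix, ← rename_perm_mul]
  congr 3
  ext
  simp

lemma creation_isHomogeneous {f : MvPolynomial (Fin (n + 1)) R} {N : ℕ} (hf : f.IsHomogeneous N)
    (i : Fin (n + 1)) : (creation i f).IsHomogeneous (N + 1) := by
  have h := (isHomogeneous_X R i).mul (hf.rename_isHomogeneous (f := i.cycleRange.symm))
  rwa [add_comm 1 N] at h

lemma coeff_creation_of_eq_zero (i : Fin (n + 1)) (f : MvPolynomial (Fin (n + 1)) R)
    {d : Fin (n + 1) →₀ ℕ} (hd : d i = 0) : coeff d (creation i f) = 0 := by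
  rw [creation_apply, mul_comm, coeff_mul_X', if_neg (by simpa using hd)]

lemma coeff_creation (i : Fin (n + 1)) (f : MvPolynomial (Fin (n + 1)) R)
    {d : Fin (n + 1) →₀ ℕ} (hd : d i ≠ 0) : coeff d (creation i f) =
      coeff (Finsupp.equivMapDomain i.cycleRange (d - Finsupp.single i 1)) f := by
  rw [creation_apply, mul_comm, coeff_mul_X', if_pos (by simpa using hd), coeff_rename_perm,
    Equiv.symm_symm]

end Creation

section Eigenfunctions

variable {n : ℕ} {R : Type*} [CommRing R] {a : R}

/-- `f` is a joint eigenfunction of the Cherednik operators, with the eigenvalues of the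
nonsymmetric Jack polynomial of index `η`. -/
def IsCherednikEigen (a : R) (η : Fin n → ℕ) (f : MvPolynomial (Fin n) R) : Prop :=
  ∀ i, cherednik a i f = C (a * η i - sortRank η i) * f

namespace IsCherednikEigen

lemma one : IsCherednikEigen a 0 (1 : MvPolynomial (Fin n) R) := fun i => by
  have hdivDiff (j : Fin n) : divDiff i j (1 : MvPolynomial (Fin n) R) = 0 :=
    divDiff_eq_zero i j (map_one _)
  simp [cherednik_apply, hdivDiff, euler_apply, sortRank_zero]

lemma const_mul {η : Fin n → ℕ} {f : MvPolynomial (Fin n) R} (h : IsCherednikEigen a η f) (c : R) :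
    IsCherednikEigen a η (C c * f) := fun i => by
  rw [cherednik_C_mul, h i, mul_left_comm]

lemma of_const_mul [IsDomain R] {η : Fin n → ℕ} {f : MvPolynomial (Fin n) R} {c : R} (hc : c ≠ 0)
    (h : IsCherednikEigen a η (C c * f)) : IsCherednikEigen a η f := fun i => by
  refine mul_left_cancel₀ (C_ne_zero.mpr hc) ?_
  rw [← cherednik_C_mul, h i, mul_left_comm]

lemma creation_last {η : Fin (n + 1) → ℕ} {f : MvPolynomial (Fin (n + 1)) R}
    (h : IsCherednikEigen a η f) :
    IsCherednikEigen a (shift (Fin.last n) η) (creation (Fin.last n) f) := by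
  intro i
  cases i using Fin.lastCases with
  | last =>
    have hrank := sortRank_shift_last η 0
    rw [Fin.cycleRange_symm_zero] at hrank
    rw [cherednik_last_creation_last, h 0, shift_self, hrank, creation_C_mul, ← add_mul, ← C_add,
      Nat.cast_add_one]
    congr 2
    ring
  | cast i =>
    have hrank := sortRank_shift_last η i.succ
    rw [cycleRange_last_symm_succ] at hrank
    rw [cherednik_castSucc_creation_last, h, shift_castSucc_of_lt (Fin.castSucc_lt_last i), hrank,
      creation_C_mul]

lemma intertwine {k k' : Fin n} (hk : (k' : ℕ) = k + 1) {η : Fin n → ℕ} (hη : η k ≠ η k')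
    {f : MvPolynomial (Fin n) R} (h : IsCherednikEigen a η f) :
    IsCherednikEigen a (η ∘ Equiv.swap k k')
      (C ((a * η k' - sortRank η k') - (a * η k - sortRank η k)) * rename (Equiv.swap k k') f
        + f) := by
  have hrename {i : Fin n} (c : R) (hi : cherednik a i f = C c * f) :
      rename (Equiv.swap k k') (cherednik a i f) = C c * rename (Equiv.swap k k') f := by
    rw [hi, map_mul, rename_C]
  intro i
  obtain ⟨i, rfl⟩ := (Equiv.swap k k').surjective i
  rw [sortRank_comp_swap hk hη, Function.comp_apply, Equiv.swap_apply_self, map_add,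
    cherednik_C_mul]
  rcases eq_or_ne i k with rfl | hik
  · have hleft := (rename_swap_cherednik_left a hk f).symm.trans (hrename _ (h i))
    rw [Equiv.swap_apply_left, h, C_sub]
    linear_combination (C (a * (η k' : R) - sortRank η k') - C (a * (η i : R) - sortRank η i))
      * hleft
  · rcases eq_or_ne i k' with rfl | hik'
    · have hright := (rename_swap_cherednik_right a hk f).symm.trans (hrename _ (h i))
      rw [Equiv.swap_apply_right, h, C_sub]
      linear_combination (C (a * (η i : R) - sortRank η i) - C (a * (η k : R) - sortRank η k))
        * hright
    · rw [Equiv.swap_apply_of_ne_of_ne hik hik', ← rename_swap_cherednik_of_ne a hk hik hik',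
        hrename _ (h i), h]
      ring

lemma cherednikSq_eq {η : Fin n → ℕ} {f : MvPolynomial (Fin n) R} (h : IsCherednikEigen a η f) :
    cherednikSq a f = C (∑ i, (a * η i - sortRank η i) ^ 2) * f := by
  rw [cherednikSq_apply, map_sum, Finset.sum_mul]
  refine Finset.sum_congr rfl fun i _ => ?_
  rw [h i, cherednik_C_mul, h i, C_pow]
  ring

end IsCherednikEigen

end Eigenfunctions

section Recursion

variable {n : ℕ} {R : Type*} [CommRing R]

/-- The coefficient of the leading term of `recursionStep`: the difference of the two eigenvalues
which are exchanged when the box added to `η` moves from position `k + 1` to position `k`. -/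
def recursionCoeff (a : R) (η : Fin (n + 1) → ℕ) (k : Fin (n + 1)) : R :=
  a * (η 0 + 1 : ℕ) - sortRank η 0 + (k + 1 : ℕ)

lemma recursionCoeff_succ (a : R) (η : Fin (n + 1) → ℕ) (k : Fin n) :
    recursionCoeff a η k.succ = recursionCoeff a η k.castSucc + 1 := by
  simp only [recursionCoeff, Fin.val_succ, Fin.val_castSucc]
  push_cast
  ring

lemma recursionCoeff_X_ne_zero (η : Fin (n + 1) → ℕ) (k : Fin (n + 1)) :
    recursionCoeff (Polynomial.X : Polynomial ℤ) η k ≠ 0 := by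
  intro h
  have hcoeff := congrArg (Polynomial.coeff · 1) h
  simp only [recursionCoeff, Polynomial.coeff_add, Polynomial.coeff_sub, Polynomial.coeff_X_mul,
    Polynomial.coeff_natCast_ite, one_ne_zero, if_true, if_false, Polynomial.coeff_zero] at hcoeff
  push_cast at hcoeff
  omega

/-- The step of the Knop–Sahi recursion. It turns the nonsymmetric Jack polynomial of index `η`
into that of index `shift k η`, provided that `η` vanishes after position `k`. -/
noncomputable def recursionStep (a : R) (η : Fin (n + 1) → ℕ) (f : MvPolynomial (Fin (n + 1)) R)
    (k : Fin (n + 1)) : MvPolynomial (Fin (n + 1)) R :=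
  C (recursionCoeff a η k) * creation k f + ∑ i ∈ Finset.Ioi k, creation i f

lemma Ioi_castSucc_eq_insert (k : Fin n) :
    Finset.Ioi k.castSucc = insert k.succ (Finset.Ioi k.succ) := by
  ext j
  simp only [Finset.mem_Ioi, Finset.mem_insert, Fin.lt_def, Fin.ext_iff, Fin.val_castSucc,
    Fin.val_succ]
  omega

lemma rename_swap_recursionStep_succ (a : R) (η : Fin (n + 1) → ℕ) {p : ℕ}
    {f : MvPolynomial (Fin (n + 1)) R} (hf : IsSymmetricFrom (p + 1) f) {k : Fin n}
    (hk : p ≤ k) :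
    rename (Equiv.swap k.castSucc k.succ) (recursionStep a η f k.succ)
      = C (recursionCoeff a η k.succ) * creation k.castSucc f
        + ∑ i ∈ Finset.Ioi k.succ, creation i f := by
  have hlt : k.castSucc < k.succ := Fin.castSucc_lt_succ
  have hfix (j : Fin (n + 1)) (hj : (j : ℕ) < p) : Equiv.swap k.castSucc k.succ j = j :=
    Equiv.swap_apply_of_ne_of_ne (Fin.ne_of_lt (hj.trans_le hk))
      (Fin.ne_of_lt ((hj.trans_le hk).trans (Nat.lt_succ_self _)))
  have hsucc : p ≤ k.succ := hk.trans (Nat.le_succ _)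
  rw [recursionStep, map_add, map_mul, rename_C, rename_creation hf hfix hsucc,
    Equiv.swap_apply_right, map_sum]
  congr 1
  refine Finset.sum_congr rfl fun i hi => ?_
  have hi : k.succ < i := Finset.mem_Ioi.mp hi
  rw [rename_creation hf hfix (hsucc.trans hi.le),
    Equiv.swap_apply_of_ne_of_ne (hlt.trans hi).ne' hi.ne']

lemma IsCherednikEigen.recursionStep [IsDomain R] {a : R} {η : Fin (n + 1) → ℕ} {p : Fin (n + 1)}
    {f : MvPolynomial (Fin (n + 1)) R} (hf : IsCherednikEigen a η f)
    (ha : ∀ k, recursionCoeff a η k ≠ 0) (hη : ∀ j, p < j → η j = 0)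
    (hsymm : IsSymmetricFrom (p + 1) f) {k : Fin (n + 1)} (hk : p ≤ k) :
    IsCherednikEigen a (shift k η) (recursionStep a η f k) := by
  induction k using Fin.reverseInduction with
  | last =>
    rw [JackPoly.recursionStep, ← Fin.top_eq_last, Finset.Ioi_top, Finset.sum_empty, add_zero]
    exact hf.creation_last.const_mul _
  | cast k ih =>
    have hlt : p < k.succ := hk.trans_lt Fin.castSucc_lt_succ
    have h := (ih hlt.le).intertwine (by simp) (shift_succ_ne (hη _ hlt))
    rw [← shift_castSucc, shift_self, shift_castSucc_of_lt Fin.castSucc_lt_succ, hη _ hlt,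
      sortRank_shift_self hη hlt.le,
      sortRank_shift_succ_castSucc k (fun j hj => hη j (hk.trans_lt hj)),
      rename_swap_recursionStep_succ a η hsymm hk] at h
    refine IsCherednikEigen.of_const_mul (ha k.succ) ?_
    convert h using 1
    have hcoeff : a * (η 0 + 1 : ℕ) - sortRank η 0 - (a * (0 : ℕ) - (k + 1 : ℕ))
        = recursionCoeff a η k.castSucc := by
      rw [recursionCoeff, Fin.val_castSucc, Nat.cast_zero]
      ring
    rw [hcoeff, JackPoly.recursionStep, JackPoly.recursionStep, recursionCoeff_succ,
      Ioi_castSucc_eq_insert, Finset.sum_insert (by simp), C_add, C_1]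
    ring

lemma IsSymmetricFrom.recursionStep (a : R) (η : Fin (n + 1) → ℕ) {p : Fin (n + 1)}
    {f : MvPolynomial (Fin (n + 1)) R} (hf : IsSymmetricFrom (p + 1) f) :
    IsSymmetricFrom (p + 1) (recursionStep a η f p) := by
  intro σ hσ
  have hσp : σ p = p := hσ p (Nat.lt_succ_self _)
  have hfix (j : Fin (n + 1)) (hj : (j : ℕ) < p) : σ j = j := hσ j (hj.trans (Nat.lt_succ_self _))
  have hlt (i : Fin (n + 1)) : p < i ↔ p < σ i := by
    refine ⟨fun h => le_perm_apply hσ h, fun h => ?_⟩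
    by_contra! hle
    rw [hσ i (Nat.lt_succ_of_le hle)] at h
    exact h.not_ge hle
  rw [JackPoly.recursionStep, map_add, map_mul, rename_C, rename_creation hf hfix le_rfl, hσp,
    map_sum]
  congr 1
  exact Finset.sum_equiv σ (fun i => by simp only [Finset.mem_Ioi, hlt i]) fun i hi =>
    rename_creation hf hfix (Finset.mem_Ioi.mp hi).le

lemma recursionStep_isHomogeneous (a : R) (η : Fin (n + 1) → ℕ) {N : ℕ}
    {f : MvPolynomial (Fin (n + 1)) R} (hf : f.IsHomogeneous N) (k : Fin (n + 1)) :
    (recursionStep a η f k).IsHomogeneous (N + 1) :=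
  ((creation_isHomogeneous hf k).C_mul _).add
    (IsHomogeneous.sum _ _ _ fun i _ => creation_isHomogeneous hf i)

/-- The normalization of the nonsymmetric Jack polynomials: all squarefree monomials of degree `N`
in the variables from the `m`-th one on have the coefficient `N!`. -/
def IsNormalizedFrom (m N : ℕ) (f : MvPolynomial (Fin n) R) : Prop :=
  ∀ d : Fin n →₀ ℕ, (∀ i, d i ≤ 1) → (∀ i : Fin n, (i : ℕ) < m → d i = 0) → d.degree = N →
    coeff d f = N.factorial

lemma IsNormalizedFrom.mono {m m' N : ℕ} (h : m ≤ m') {f : MvPolynomial (Fin n) R}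
    (hf : IsNormalizedFrom m N f) : IsNormalizedFrom m' N f :=
  fun d hd hd0 => hf d hd fun i hi => hd0 i (hi.trans_le h)

lemma IsNormalizedFrom.coeff_creation {p N : ℕ} {f : MvPolynomial (Fin (n + 1)) R}
    (hf : IsNormalizedFrom (p + 1) N f) {d : Fin (n + 1) →₀ ℕ} (hd : ∀ i, d i ≤ 1)
    (hd0 : ∀ i : Fin (n + 1), (i : ℕ) < p + 1 → d i = 0) (hdeg : d.degree = N + 1)
    {i : Fin (n + 1)} (hi : p < i) :
    coeff d (creation i f) = d i * N.factorial := by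
  by_cases hdi : d i = 0
  · rw [coeff_creation_of_eq_zero i f hdi, hdi, Nat.cast_zero, zero_mul]
  have hdi1 : d i = 1 := le_antisymm (hd i) (Nat.one_le_iff_ne_zero.mpr hdi)
  rw [JackPoly.coeff_creation i f hdi, hdi1, Nat.cast_one, one_mul]
  refine hf _ (fun j => (Nat.sub_le _ _).trans (hd _)) (fun j hj => ?_) ?_
  · induction j using Fin.cases with
    | zero => simp [hdi1]
    | succ j =>
      have hjp : (j : ℕ) < p := by simpa using hj
      rw [Finsupp.equivMapDomain_apply, Finsupp.tsub_apply,
        cycleRange_symm_succ_of_castSucc_lt (Fin.lt_def.mpr (hjp.trans hi)),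
        hd0 j.castSucc (hjp.trans (Nat.lt_succ_self _)), Nat.zero_sub]
  · have hsplit : (d - Finsupp.single i 1).degree + 1 = d.degree := by
      simpa [hdi1] using congrArg Finsupp.degree
        (tsub_add_cancel_of_le (show Finsupp.single i 1 ≤ d by simp [hdi1]))
    rw [Finsupp.equivMapDomain_eq_mapDomain, Finsupp.degree_mapDomain]
    omega

lemma IsNormalizedFrom.recursionStep (a : R) (η : Fin (n + 1) → ℕ) {p : Fin (n + 1)} {N : ℕ}
    {f : MvPolynomial (Fin (n + 1)) R} (hf : IsNormalizedFrom (p + 1) N f) :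
    IsNormalizedFrom (p + 1) (N + 1) (recursionStep a η f p) := by
  intro d hd hd0 hdeg
  have hsum : ∑ i ∈ Finset.Ioi p, d i = d.degree := by
    rw [Finsupp.degree_eq_sum]
    refine Finset.sum_subset (Finset.subset_univ _) fun j _ hj => hd0 j ?_
    exact Nat.lt_succ_of_le (Fin.le_def.mp (not_lt.mp fun h => hj (Finset.mem_Ioi.mpr h)))
  rw [JackPoly.recursionStep, coeff_add, coeff_C_mul,
    coeff_creation_of_eq_zero p f (hd0 p (Nat.lt_succ_self _)), mul_zero, zero_add, coeff_sum,
    Finset.sum_congr rfl fun i hi =>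
      hf.coeff_creation hd hd0 hdeg (Fin.lt_def.mp (Finset.mem_Ioi.mp hi)),
    ← Finset.sum_mul, ← Nat.cast_sum, hsum, hdeg, Nat.factorial_succ, Nat.cast_mul]

end Recursion

section IntegralJack

variable {n : ℕ}

/-- `F` is an integral multiple, suitably normalized, of the nonsymmetric Jack polynomial attached
to the composition `η`, which should vanish from position `m` on. The polynomial variable of the
coefficients is the parameter of the Cherednik operators. -/
structure IsIntegralJack (η : Fin (n + 1) → ℕ) (m : ℕ)
    (F : MvPolynomial (Fin (n + 1)) (Polynomial ℤ)) : Prop where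
  eigen : IsCherednikEigen Polynomial.X η F
  symm : IsSymmetricFrom m F
  homogeneous : F.IsHomogeneous (∑ i, η i)
  normalized : IsNormalizedFrom m (∑ i, η i) F

namespace IsIntegralJack

lemma mono {η : Fin (n + 1) → ℕ} {m m' : ℕ} (h : m ≤ m')
    {F : MvPolynomial (Fin (n + 1)) (Polynomial ℤ)} (hF : IsIntegralJack η m F) :
    IsIntegralJack η m' F :=
  ⟨hF.eigen, hF.symm.mono h, hF.homogeneous, hF.normalized.mono h⟩

lemma one (m : ℕ) : IsIntegralJack (0 : Fin (n + 1) → ℕ) m 1 where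
  eigen := .one
  symm σ _ := map_one _
  homogeneous := by simpa using isHomogeneous_one _ _
  normalized d _ _ hd := by
    have hd0 : d = 0 := by simpa [Finsupp.degree_eq_zero_iff] using hd
    simp [hd0]

lemma recursionStep {η : Fin (n + 1) → ℕ} {p : Fin (n + 1)} (hη : ∀ j, p < j → η j = 0)
    {F : MvPolynomial (Fin (n + 1)) (Polynomial ℤ)} (hF : IsIntegralJack η (p + 1) F) :
    IsIntegralJack (shift p η) (p + 1) (recursionStep Polynomial.X η F p) where
  eigen := hF.eigen.recursionStep (recursionCoeff_X_ne_zero η) hη hF.symm le_rfl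
  symm := hF.symm.recursionStep _ _
  homogeneous := by
    rw [sum_shift]
    exact recursionStep_isHomogeneous _ _ hF.homogeneous p
  normalized := by
    rw [sum_shift]
    exact hF.normalized.recursionStep _ _

end IsIntegralJack

lemma exists_last_ne_zero {η : Fin n → ℕ} (h : ∑ i, η i ≠ 0) :
    ∃ p, η p ≠ 0 ∧ ∀ j, p < j → η j = 0 := by
  obtain ⟨i, -, hi⟩ := Finset.exists_ne_zero_of_sum_ne_zero h
  obtain ⟨p, hp, hmax⟩ := Finset.exists_maximal (s := Finset.univ.filter fun j => η j ≠ 0)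
    ⟨i, Finset.mem_filter.mpr ⟨Finset.mem_univ i, hi⟩⟩
  refine ⟨p, (Finset.mem_filter.mp hp).2, fun j hj => ?_⟩
  by_contra hj0
  exact hj.not_ge (hmax (Finset.mem_filter.mpr ⟨Finset.mem_univ j, hj0⟩) hj.le)

theorem exists_isIntegralJack (m : ℕ) (η : Fin (n + 1) → ℕ)
    (hη : ∀ j : Fin (n + 1), m ≤ j → η j = 0) : ∃ F, IsIntegralJack η m F := by
  obtain ⟨N, hN⟩ : ∃ N, ∑ i, η i = N := ⟨_, rfl⟩
  induction N generalizing m η with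
  | zero =>
    obtain rfl : η = 0 := by simpa [funext_iff] using hN
    exact ⟨1, .one m⟩
  | succ N ih =>
    obtain ⟨p, hp, hlast⟩ := exists_last_ne_zero (η := η) (by omega)
    obtain ⟨η', rfl⟩ := exists_shift_eq p hp
    rw [sum_shift, Nat.add_right_cancel_iff] at hN
    have hlast' (j : Fin (n + 1)) (hj : p < j) : η' j = 0 := by
      rw [← shift_of_lt hj η', hlast j hj]
    obtain ⟨F, hF⟩ := ih (p + 1) η' (fun j hj => hlast' j hj) hN
    have hpm : (p : ℕ) + 1 ≤ m := not_le.mp fun h => hp (hη p h)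
    exact ⟨_, (hF.recursionStep hlast').mono hpm⟩

end IntegralJack

section MonomialDividedDifference

variable {ι R : Type*} [CommRing R] [DecidableEq ι]

lemma rename_swap_monomial {i j : ι} {ρ : ι →₀ ℕ} (h : ρ i = ρ j) (c : R) :
    rename (Equiv.swap i j) (monomial ρ c) = monomial ρ c := by
  rw [rename_monomial]
  congr 2
  ext k
  rw [← Equiv.swap_apply_self i j k, Finsupp.mapDomain_apply (Equiv.swap i j).injective,
    Equiv.swap_apply_self]
  rcases eq_or_ne k i with rfl | hki
  · rw [Equiv.swap_apply_left, h]
  · rcases eq_or_ne k j with rfl | hkj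
    · rw [Equiv.swap_apply_right, h]
    · rw [Equiv.swap_apply_of_ne_of_ne hki hkj]

lemma divDiff_X_pow {i j : ι} (hij : i ≠ j) (r : ℕ) :
    divDiff i j (X i ^ r : MvPolynomial ι R) =
      ∑ u ∈ Finset.range r, X i ^ u * X j ^ (r - 1 - u) := by
  refine divDiff_eq_of_X_sub_X_mul_eq hij ?_
  rw [map_pow, rename_X, Equiv.swap_apply_left, mul_comm]
  exact geom_sum₂_mul _ _ _

lemma divDiff_monomial {i j : ι} (hij : i ≠ j) {ρ : ι →₀ ℕ} (hρ : ρ i = ρ j) (r : ℕ) (c : R) :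
    divDiff i j (monomial (ρ + Finsupp.single i r) c) =
      ∑ u ∈ Finset.range r,
        monomial (ρ + Finsupp.single i u + Finsupp.single j (r - 1 - u)) c := by
  have hmon (d : ι →₀ ℕ) (k : ι) (s : ℕ) :
      (monomial (d + Finsupp.single k s) c : MvPolynomial ι R) = monomial d c * X k ^ s := by
    rw [X_pow_eq_monomial, monomial_mul, mul_one]
  simp only [hmon]
  rw [divDiff_mul_of_rename_swap_eq (rename_swap_monomial hρ c), divDiff_X_pow hij,
    Finset.mul_sum]
  exact Finset.sum_congr rfl fun u _ => (mul_assoc _ _ _).symm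

end MonomialDividedDifference

section Excess

variable {ι : Type*} [Fintype ι]

/-- The sum of the truncated differences `κ_i - t`. Dominance of partitions amounts to comparing
these numbers for all `t`, and unlike partial sums they need no sorting of the entries. -/
def excess (t : ℕ) (κ : ι → ℕ) : ℕ := ∑ i, (κ i - t)

lemma excess_comp_equiv (t : ℕ) (κ : ι → ℕ) (σ : Equiv.Perm ι) :
    excess t (κ ∘ σ) = excess t κ :=
  Equiv.sum_comp σ fun i => κ i - t

lemma excess_single_add_single_le {i j : ι} (hij : i ≠ j) (t : ℕ) {ρ : ι →₀ ℕ} (hρ : ρ i = ρ j)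
    (u v : ℕ) :
    excess t (ρ + Finsupp.single i u + Finsupp.single j v) ≤
      excess t (ρ + Finsupp.single i (u + v)) := by
  classical
  have split (G : ι → ℕ) : ∑ k, G k = (G i + G j) + ∑ k ∈ ({i, j} : Finset ι)ᶜ, G k := by
    rw [← Finset.sum_pair hij, Finset.sum_add_sum_compl]
  have hrest : ∑ k ∈ ({i, j} : Finset ι)ᶜ,
      ((ρ + Finsupp.single i u + Finsupp.single j v) k - t) =
      ∑ k ∈ ({i, j} : Finset ι)ᶜ, ((ρ + Finsupp.single i (u + v)) k - t) := by
    refine Finset.sum_congr rfl fun k hk => ?_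
    simp only [Finset.mem_compl, Finset.mem_insert, Finset.mem_singleton, not_or] at hk
    simp [Ne.symm hk.1, Ne.symm hk.2]
  rw [excess, excess, split, split, hrest]
  simp only [Finsupp.coe_add, Pi.add_apply, Finsupp.single_eq_same, Finsupp.single_eq_of_ne hij,
    Finsupp.single_eq_of_ne hij.symm, hρ]
  omega

variable {R : Type*} [CommRing R]

/-- The polynomials whose coefficients at the monomials of `t`-excess larger than `M` lie
in `A`. -/
def excessFiltration (ι : Type*) [Fintype ι] (t M : ℕ) (A : AddSubgroup R) :
    AddSubgroup (MvPolynomial ι R) where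
  carrier := {f | ∀ κ : ι →₀ ℕ, M < excess t κ → coeff κ f ∈ A}
  add_mem' hf hg κ h := by rw [coeff_add]; exact A.add_mem (hf κ h) (hg κ h)
  zero_mem' κ _ := by rw [coeff_zero]; exact A.zero_mem
  neg_mem' hf κ h := by rw [coeff_neg]; exact A.neg_mem (hf κ h)

variable {t M : ℕ} {A : AddSubgroup R}

lemma monomial_mem_excessFiltration {κ : ι →₀ ℕ} {c : R} :
    monomial κ c ∈ excessFiltration ι t M A ↔ (M < excess t κ → c ∈ A) := by
  classical
  refine ⟨fun h hκ => by simpa using h κ hκ, fun h κ' hκ' => ?_⟩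
  rw [coeff_monomial]
  split_ifs with he
  · exact h (he ▸ hκ')
  · exact A.zero_mem

variable [DecidableEq ι]

lemma X_mul_divDiff_monomial_mem_excessFiltration {i j : ι} (hij : i ≠ j) {κ : ι →₀ ℕ}
    (hκ : κ j ≤ κ i) {c : R} (h : monomial κ c ∈ excessFiltration ι t M A) {l : ι}
    (hl : l = i ∨ l = j) : X l * divDiff i j (monomial κ c) ∈ excessFiltration ι t M A := by
  obtain ⟨ρ, r, hρ, rfl⟩ : ∃ (ρ : ι →₀ ℕ) (r : ℕ), ρ i = ρ j ∧ κ = ρ + Finsupp.single i r := by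
    refine ⟨κ - Finsupp.single i (κ i - κ j), κ i - κ j, ?_, ?_⟩
    · simp [hij, Nat.sub_sub_self hκ]
    · rw [tsub_add_cancel_of_le (Finsupp.single_le_iff.mpr (Nat.sub_le _ _))]
  have hmem (u v : ℕ) (huv : u + v = r) :
      monomial (ρ + Finsupp.single i u + Finsupp.single j v) c ∈ excessFiltration ι t M A := by
    subst huv
    exact monomial_mem_excessFiltration.mpr fun hlt => monomial_mem_excessFiltration.mp h
      (hlt.trans_le (excess_single_add_single_le hij t hρ u v))
  rw [divDiff_monomial hij hρ, Finset.mul_sum]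
  refine AddSubgroup.sum_mem _ fun u hu => ?_
  have hu := Finset.mem_range.mp hu
  rw [X, monomial_mul, one_mul]
  rcases hl with rfl | rfl
  · convert hmem (u + 1) (r - 1 - u) (by omega) using 3
    rw [Finsupp.single_add]
    abel
  · convert hmem u (r - 1 - u + 1) (by omega) using 3
    rw [Finsupp.single_add]
    abel

lemma X_mul_divDiff_mem_excessFiltration (i j : ι) {f : MvPolynomial ι R}
    (h : f ∈ excessFiltration ι t M A) {l : ι} (hl : l = i ∨ l = j) :
    X l * divDiff i j f ∈ excessFiltration ι t M A := by
  rcases eq_or_ne i j with rfl | hij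
  · simp
  rw [f.as_sum, map_sum, Finset.mul_sum]
  refine AddSubgroup.sum_mem _ fun κ _ => ?_
  have hmem : monomial κ (coeff κ f) ∈ excessFiltration ι t M A :=
    monomial_mem_excessFiltration.mpr (h κ)
  rcases le_total (κ j) (κ i) with hκ | hκ
  · exact X_mul_divDiff_monomial_mem_excessFiltration hij hκ hmem hl
  · rw [divDiff_swap j i, mul_neg]
    exact neg_mem (X_mul_divDiff_monomial_mem_excessFiltration hij.symm hκ hmem hl.symm)

end Excess

section Triangularity

variable {n : ℕ}

lemma IsCherednikEigen.coeff_eq {R : Type*} [CommRing R] {a : R} {η : Fin n → ℕ}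
    {F : MvPolynomial (Fin n) R} (h : IsCherednikEigen a η F) (i : Fin n) (κ : Fin n →₀ ℕ) :
    a * (((κ i : R) - η i) * coeff κ F) = ((i : ℕ) : ℤ) • coeff κ F
      - (sortRank η i : ℤ) • coeff κ F - coeff κ (∑ j, X (max i j) * divDiff i j F) := by
  have hi := congrArg (coeff κ) (h i)
  rw [cherednik_apply, coeff_sub, coeff_add, coeff_C_mul, coeff_C_mul, coeff_euler,
    ← C_eq_coe_nat, coeff_C_mul] at hi
  simp only [zsmul_eq_mul, Int.cast_natCast]
  linear_combination hi

variable {S : Type*} [CommRing S]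

lemma mem_degreeLT_of_X_mul_C_mul_mem [IsDomain S] {c : S} (hc : c ≠ 0) {k : ℕ}
    {p : Polynomial S} (h : Polynomial.X * (Polynomial.C c * p) ∈ Polynomial.degreeLT S (k + 1)) :
    p ∈ Polynomial.degreeLT S k := by
  rw [Polynomial.mem_degreeLT, Polynomial.degree_lt_iff_coeff_zero] at h ⊢
  intro m hm
  simpa [hc] using h (m + 1) (by omega)

/-- The polynomials whose coefficients at the monomials of `t`-excess larger than `M` have degree
less than `k` in the parameter. -/
noncomputable def degreeFiltration (S : Type*) [CommRing S] (n t M k : ℕ) :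
    AddSubgroup (MvPolynomial (Fin n) (Polynomial S)) :=
  excessFiltration (Fin n) t M (Polynomial.degreeLT S k).toAddSubgroup

lemma exists_mem_degreeFiltration (t M : ℕ) (F : MvPolynomial (Fin n) (Polynomial S)) :
    ∃ k, F ∈ degreeFiltration S n t M k := by
  refine ⟨F.support.sup (fun κ => (coeff κ F).natDegree) + 1, fun κ _ => ?_⟩
  rw [Submodule.mem_toAddSubgroup, Polynomial.mem_degreeLT,
    Polynomial.degree_lt_iff_coeff_zero]
  intro m hm
  refine Polynomial.coeff_eq_zero_of_natDegree_lt ?_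
  by_cases hκ : κ ∈ F.support
  · have := Finset.le_sup (f := fun κ => (coeff κ F).natDegree) hκ
    omega
  · rw [notMem_support_iff.mp hκ, Polynomial.natDegree_zero]
    omega

variable [IsDomain S] [CharZero S] {η : Fin n → ℕ} {F : MvPolynomial (Fin n) (Polynomial S)}

/-- Up to terms which do not grow in the parameter, `ξ_i` is `α` times the diagonal operator
`x_i ∂_i`, whose eigenvalues tell `κ` from `η`. -/
lemma IsCherednikEigen.mem_degreeFiltration (hF : IsCherednikEigen Polynomial.X η F) (t : ℕ)
    {k : ℕ} (hk : F ∈ degreeFiltration S n t (excess t η) (k + 1)) :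
    F ∈ degreeFiltration S n t (excess t η) k := fun κ hκ => by
  obtain ⟨i, hi⟩ : ∃ i, κ i ≠ η i := by
    by_contra! h
    rw [funext h] at hκ
    exact lt_irrefl _ hκ
  have hsum : coeff κ (∑ j, X (max i j) * divDiff i j F) ∈
      (Polynomial.degreeLT S (k + 1)).toAddSubgroup :=
    (AddSubgroup.sum_mem (excessFiltration (Fin n) t (excess t η) _) fun j _ =>
      X_mul_divDiff_mem_excessFiltration i j hk (max_choice i j)) κ hκ
  refine mem_degreeLT_of_X_mul_C_mul_mem (c := (κ i : S) - η i)
    (sub_ne_zero.mpr (Nat.cast_injective.ne hi)) ?_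
  rw [Polynomial.C_sub, Polynomial.C_eq_natCast, Polynomial.C_eq_natCast, hF.coeff_eq]
  exact sub_mem (sub_mem (zsmul_mem (hk κ hκ) _) (zsmul_mem (hk κ hκ) _)) hsum

theorem IsCherednikEigen.excess_le (hF : IsCherednikEigen Polynomial.X η F) (t : ℕ)
    {κ : Fin n →₀ ℕ} (hκ : coeff κ F ≠ 0) : excess t κ ≤ excess t η := by
  have descend (k : ℕ) (hk : F ∈ degreeFiltration S n t (excess t η) k) :
      F ∈ degreeFiltration S n t (excess t η) 0 := by
    induction k with
    | zero => exact hk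
    | succ k ih => exact ih (hF.mem_degreeFiltration t hk)
  by_contra! hlt
  obtain ⟨k, hk⟩ := exists_mem_degreeFiltration t (excess t η) F
  have h0 := descend k hk κ hlt
  rw [Submodule.mem_toAddSubgroup, Polynomial.mem_degreeLT, Nat.cast_zero,
    Nat.WithBot.lt_zero_iff, Polynomial.degree_eq_bot] at h0
  exact hκ h0

end Triangularity

section Parts

variable {N : ℕ}

/-- The `i`-th largest part of `lam`, counted from `0`, or `0` if there is none. -/
def part (lam : N.Partition) (i : ℕ) : ℕ := (lam.parts.sort (· ≥ ·)).getD i 0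

lemma length_sort_parts (lam : N.Partition) :
    (lam.parts.sort (· ≥ ·)).length = len lam :=
  Multiset.length_sort _

lemma sum_range_getD {M : Type*} [AddCommMonoid M] (g : ℕ → M) (hg : g 0 = 0) (l : List ℕ) {K : ℕ}
    (hK : l.length ≤ K) : ∑ i ∈ Finset.range K, g (l.getD i 0) = (l.map g).sum := by
  induction l generalizing K with
  | nil => simp [hg]
  | cons x l ih =>
    obtain ⟨K, rfl⟩ := Nat.exists_eq_succ_of_ne_zero (Nat.ne_zero_of_lt hK)
    rw [Finset.sum_range_succ']
    simp only [List.getD_cons_succ, List.getD_cons_zero, List.map_cons, List.sum_cons]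
    rw [ih (Nat.le_of_succ_le_succ hK), add_comm]

lemma sum_range_part {M : Type*} [AddCommMonoid M] (lam : N.Partition) (g : ℕ → M) (hg : g 0 = 0)
    {K : ℕ} (hK : len lam ≤ K) :
    ∑ i ∈ Finset.range K, g (part lam i) = (lam.parts.map g).sum := by
  simp only [part]
  rw [sum_range_getD g hg _ ((length_sort_parts lam).trans_le hK), ← Multiset.sum_coe,
    ← Multiset.map_coe, Multiset.sort_eq]

lemma part_eq_zero {lam : N.Partition} {i : ℕ} (h : len lam ≤ i) : part lam i = 0 :=
  List.getD_eq_default _ _ ((length_sort_parts lam).trans_le h)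

lemma part_pos {lam : N.Partition} {i : ℕ} (h : i < len lam) : 0 < part lam i := by
  rw [part, List.getD_eq_getElem _ _ (h.trans_eq (length_sort_parts lam).symm)]
  exact lam.parts_pos ((Multiset.mem_sort (· ≥ ·)).mp (List.getElem_mem _))

lemma part_antitone (lam : N.Partition) : Antitone (part lam) := by
  intro i j hij
  rcases hij.eq_or_lt with rfl | hij
  · rfl
  rcases lt_or_ge j (len lam) with hj | hj
  · have hlen := length_sort_parts lam
    rw [part, part, List.getD_eq_getElem _ _ (by omega), List.getD_eq_getElem _ _ (by omega)]
    exact List.pairwise_iff_getElem.mp (Multiset.pairwise_sort lam.parts (· ≥ ·)) i j _ _ hij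
  · exact (part_eq_zero hj).trans_le (Nat.zero_le _)

lemma part_injective : Function.Injective (part : N.Partition → ℕ → ℕ) := by
  intro lam mu h
  have hlen : len lam = len mu := by
    rcases lt_trichotomy (len lam) (len mu) with hlt | heq | hlt
    · exact absurd (h ▸ part_eq_zero le_rfl : part mu (len lam) = 0) (part_pos hlt).ne'
    · exact heq
    · exact absurd (h.symm ▸ part_eq_zero le_rfl : part lam (len mu) = 0) (part_pos hlt).ne'
  have hsort : lam.parts.sort (· ≥ ·) = mu.parts.sort (· ≥ ·) := by
    refine List.ext_getElem (by simpa only [length_sort_parts] using hlen) fun i hi hi' => ?_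
    simpa only [part, List.getD_eq_getElem _ _ hi, List.getD_eq_getElem _ _ hi'] using congrFun h i
  refine Nat.Partition.ext ?_
  rw [← Multiset.sort_eq lam.parts (· ≥ ·), hsort, Multiset.sort_eq]

lemma partialSum_succ (lam : N.Partition) (k : ℕ) :
    partialSum lam (k + 1) = partialSum lam k + part lam k := by
  rw [partialSum, partialSum, List.take_add_one, List.sum_append, part,
    List.getD_eq_getElem?_getD]
  cases (lam.parts.sort (· ≥ ·))[k]? <;> simp

lemma partialSum_eq_sum_part (lam : N.Partition) (k : ℕ) :
    partialSum lam k = ∑ i ∈ Finset.range k, part lam i := by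
  induction k with
  | zero => simp [partialSum]
  | succ k ih => rw [partialSum_succ, Finset.sum_range_succ, ih]

lemma sum_part (lam : N.Partition) {K : ℕ} (hK : len lam ≤ K) :
    ∑ i ∈ Finset.range K, part lam i = N := by
  simpa [lam.parts_sum] using sum_range_part lam id rfl hK

lemma domLE_of_sum_tsub_le {lam mu : N.Partition}
    (h : ∀ t, (mu.parts.map (· - t)).sum ≤ (lam.parts.map (· - t)).sum) : DomLE mu lam := by
  intro k
  set t := part lam k
  set K := max k (max (len lam) (len mu))
  have hk : Finset.range k ⊆ Finset.range K := Finset.range_mono (le_max_left _ _)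
  have hlam : ∑ i ∈ Finset.range k, part lam i =
      ∑ i ∈ Finset.range K, (part lam i - t) + ∑ _i ∈ Finset.range k, t := by
    rw [← Finset.sum_subset hk fun _ _ hi => Nat.sub_eq_zero_of_le
      (part_antitone lam (not_lt.mp (mt Finset.mem_range.mpr hi))), ← Finset.sum_add_distrib]
    exact Finset.sum_congr rfl fun _ hi =>
      (Nat.sub_add_cancel (part_antitone lam (Finset.mem_range.mp hi).le)).symm
  calc partialSum mu k = ∑ i ∈ Finset.range k, part mu i := partialSum_eq_sum_part mu k
    _ ≤ ∑ i ∈ Finset.range k, ((part mu i - t) + t) :=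
        Finset.sum_le_sum fun _ _ => le_tsub_add
    _ ≤ ∑ i ∈ Finset.range K, (part mu i - t) + ∑ _i ∈ Finset.range k, t := by
        rw [Finset.sum_add_distrib]
        exact Nat.add_le_add_right (Finset.sum_le_sum_of_subset hk) _
    _ ≤ ∑ i ∈ Finset.range K, (part lam i - t) + ∑ _i ∈ Finset.range k, t := by
        rw [sum_range_part mu (· - t) (Nat.zero_sub t) (by omega),
          sum_range_part lam (· - t) (Nat.zero_sub t) (by omega)]
        exact Nat.add_le_add_right (h t) _
    _ = partialSum lam k := by rw [partialSum_eq_sum_part, hlam]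

lemma excess_eq_of_vals_eq {n : ℕ} {κ : Fin n →₀ ℕ} {mu : N.Partition} (h : vals κ = mu.parts)
    (t : ℕ) : excess t κ = (mu.parts.map (· - t)).sum := by
  rw [← h, vals, Multiset.map_map]
  refine (Finset.sum_subset (Finset.subset_univ κ.support) fun i _ hi => ?_).symm
  rw [Finsupp.notMem_support_iff.mp hi, Nat.zero_sub]

lemma excess_part {n : ℕ} (lam : N.Partition) (hn : len lam ≤ n) (t : ℕ) :
    excess t (fun i : Fin n => part lam i) = (lam.parts.map (· - t)).sum := by
  rw [← sum_range_part lam (· - t) (Nat.zero_sub t) hn, excess,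
    Finset.sum_range (fun i => part lam i - t)]

lemma sum_partialSum_add_sum_mul_part (lam : N.Partition) (k : ℕ) :
    ∑ i ∈ Finset.range k, partialSum lam (i + 1) + ∑ i ∈ Finset.range k, i * part lam i =
      k * partialSum lam k := by
  induction k with
  | zero => simp
  | succ k ih =>
    rw [Finset.sum_range_succ, Finset.sum_range_succ, partialSum_succ]
    linarith

lemma eq_of_partialSum_eq {lam mu : N.Partition} {K : ℕ} (hl : len lam ≤ K) (hm : len mu ≤ K)
    (h : ∀ k < K, partialSum lam (k + 1) = partialSum mu (k + 1)) : lam = mu := by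
  refine part_injective (funext fun j => ?_)
  rcases lt_or_ge j K with hj | hj
  · have hj₁ := h j hj
    have hj₀ : partialSum lam j = partialSum mu j := by
      cases j with
      | zero => simp [partialSum]
      | succ j => exact h j (by omega)
    rw [partialSum_succ, partialSum_succ, hj₀] at hj₁
    exact Nat.add_left_cancel hj₁
  · rw [part_eq_zero (hl.trans hj), part_eq_zero (hm.trans hj)]

/-- By Abel summation, equality of the sums `∑ i λ_i` forces equality of all partial sums. -/
lemma eq_of_domLE_of_sum_mul_part_eq {K : ℕ} {lam mu : N.Partition} (hle : DomLE mu lam)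
    (hl : len lam ≤ K) (hm : len mu ≤ K)
    (h : ∑ i ∈ Finset.range K, i * part lam i = ∑ i ∈ Finset.range K, i * part mu i) :
    mu = lam := by
  have htot : partialSum mu K = partialSum lam K := by
    rw [partialSum_eq_sum_part, partialSum_eq_sum_part, sum_part mu hm, sum_part lam hl]
  have hsum : ∑ i ∈ Finset.range K, partialSum mu (i + 1)
      = ∑ i ∈ Finset.range K, partialSum lam (i + 1) := by
    have hmu := sum_partialSum_add_sum_mul_part mu K
    have hlam := sum_partialSum_add_sum_mul_part lam K
    rw [htot] at hmu
    omega
  have heq := (Finset.sum_eq_sum_iff_of_le fun i _ => hle (i + 1)).mp hsum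
  exact eq_of_partialSum_eq hm hl fun k hk => heq k (Finset.mem_range.mpr hk)

end Parts

section Rotation

/-- The exponent vector `(1, …, 1, 0, …, 0)` of the product of the first `m` variables. -/
noncomputable def initialExp (n m : ℕ) : Fin n →₀ ℕ :=
  Finsupp.equivFunOnFinite.symm fun i => if (i : ℕ) < m then 1 else 0

variable {n : ℕ}

lemma initialExp_apply (m : ℕ) (i : Fin n) : initialExp n m i = if (i : ℕ) < m then 1 else 0 := rfl

lemma initialExp_zero : initialExp n 0 = 0 := by
  ext i
  simp [initialExp_apply]

lemma initialExp_succ (j : Fin n) : initialExp n (j + 1) = Finsupp.single j 1 + initialExp n j := by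
  ext i
  simp only [initialExp_apply, Finsupp.add_apply, Finsupp.single_apply, Fin.ext_iff]
  split_ifs <;> omega

lemma degree_initialExp {m : ℕ} (hm : m ≤ n) : (initialExp n m).degree = m := by
  simp only [Finsupp.degree_eq_sum, initialExp_apply, Finset.sum_boole, Nat.cast_id]
  rw [Fin.card_filter_val_lt, min_eq_right hm]

/-- The rotation `i ↦ i - 1` of the variables. -/
abbrev rotation (n : ℕ) : Equiv.Perm (Fin (n + 1)) := (Fin.last n).cycleRange.symm

lemma val_rotation (i : Fin (n + 1)) :
    (rotation n i : ℕ) = if (i : ℕ) = 0 then n else i - 1 := by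
  cases i using Fin.cases with
  | zero => simp [rotation]
  | succ i => rw [rotation, cycleRange_last_symm_succ]; simp

lemma val_rotation_pow {j : ℕ} (hj : j ≤ n + 1) (i : Fin (n + 1)) :
    ((rotation n ^ j) i : ℕ) = if (i : ℕ) < j then i + (n + 1) - j else i - j := by
  induction j with
  | zero => simp
  | succ j ih =>
    rw [pow_succ', Equiv.Perm.mul_apply, val_rotation, ih (by omega)]
    have := i.isLt
    split_ifs <;> omega

lemma rotation_pow_succ_self (j : Fin (n + 1)) :
    (rotation n ^ ((j : ℕ) + 1)) j = Fin.last n := by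
  refine Fin.ext ?_
  rw [val_rotation_pow j.isLt, if_pos (Nat.lt_succ_self _), Fin.val_last]
  omega

lemma shift_last_comp_rotation_pow (ν : Fin (n + 1) → ℕ) (j : Fin (n + 1)) :
    shift (Fin.last n) ((ν + ⇑(initialExp (n + 1) j)) ∘ (rotation n ^ (j : ℕ)).symm) =
      (ν + ⇑(initialExp (n + 1) (j + 1))) ∘ (rotation n ^ ((j : ℕ) + 1)).symm := by
  funext i
  obtain ⟨i, rfl⟩ := (rotation n ^ ((j : ℕ) + 1)).surjective i
  have hcycle : (Fin.last n).cycleRange ((rotation n ^ ((j : ℕ) + 1)) i) =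
      (rotation n ^ (j : ℕ)) i := by
    rw [pow_succ', Equiv.Perm.mul_apply, Equiv.apply_symm_apply]
  have hlast : (rotation n ^ ((j : ℕ) + 1)) i = Fin.last n ↔ i = j := by
    rw [← rotation_pow_succ_self j, (rotation n ^ ((j : ℕ) + 1)).apply_eq_iff_eq]
  simp only [shift, hcycle, hlast, Function.comp_apply, Equiv.symm_apply_apply, Pi.add_apply,
    initialExp_succ, Finsupp.add_apply, Finsupp.single_apply, eq_comm (a := j)]
  ring

/-- Applying the creation operator `j` times multiplies by `x_0 ⋯ x_{j-1}` and rotates. -/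
lemma IsCherednikEigen.rotate {R : Type*} [CommRing R] {a : R} {ν : Fin (n + 1) → ℕ}
    {F : MvPolynomial (Fin (n + 1)) R} (hF : IsCherednikEigen a ν F) {j : ℕ} (hj : j ≤ n + 1) :
    IsCherednikEigen a ((ν + ⇑(initialExp (n + 1) j)) ∘ (rotation n ^ j).symm)
      (rename (rotation n ^ j) (monomial (initialExp (n + 1) j) 1 * F)) := by
  induction j with
  | zero =>
    rw [initialExp_zero, Finsupp.coe_zero, add_zero, pow_zero, rename_perm_one, monomial_zero',
      C_1, one_mul]
    exact hF
  | succ j ih =>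
    obtain ⟨j, rfl⟩ : ∃ i : Fin (n + 1), (i : ℕ) = j := ⟨⟨j, hj⟩, rfl⟩
    have h := (ih (by omega)).creation_last
    have hX : X (Fin.last n) =
        rename (rotation n ^ ((j : ℕ) + 1)) (X j : MvPolynomial (Fin (n + 1)) R) := by
      rw [rename_X, rotation_pow_succ_self]
    rwa [shift_last_comp_rotation_pow, creation_apply, hX, ← rename_perm_mul, ← pow_succ',
      ← map_mul, ← mul_assoc, X, monomial_mul, one_mul, ← initialExp_succ] at h

lemma sortRank_of_antitone {η : Fin n → ℕ} (hη : Antitone η) (i : Fin n) :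
    sortRank η i = i := by
  have hiff (j : Fin n) : (η i < η j ∨ (η j = η i ∧ j < i)) ↔ j < i := by
    refine ⟨fun h => h.elim (fun hlt => hη.reflect_lt hlt) And.right, fun hlt => ?_⟩
    rcases (hη hlt.le).lt_or_eq with h | h
    · exact Or.inl h
    · exact Or.inr ⟨h.symm, hlt⟩
  simp [sortRank, hiff, Finset.filter_gt_eq_Iio]

lemma sortRank_comp_rotation_pow {η : Fin (n + 1) → ℕ} (hη : Antitone η) {m : ℕ}
    (hm : m ≤ n + 1) (hpos : ∀ i : Fin (n + 1), 0 < η i ↔ (i : ℕ) < m) (i : Fin (n + 1)) :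
    sortRank (η ∘ (rotation n ^ m).symm) ((rotation n ^ m) i) = i := by
  conv_rhs => rw [← sortRank_of_antitone hη i]
  refine sortRank_apply_perm _ i fun j => ?_
  simp only [Function.comp_apply, Equiv.symm_apply_apply]
  refine or_congr_right (and_congr_right fun hij => ?_)
  have hside : (j : ℕ) < m ↔ (i : ℕ) < m := by rw [← hpos, ← hpos, hij]
  simp only [Fin.lt_def, val_rotation_pow hm]
  split_ifs <;> omega

end Rotation

section Conjugation

variable {n : ℕ} {R : Type*} [CommRing R] {η : Fin n → ℕ} {σ : Equiv.Perm (Fin n)}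

lemma IsCherednikEigen.cherednikSq_eq_of_rename {a : R} {G : MvPolynomial (Fin n) R}
    (h : IsCherednikEigen a (η ∘ σ.symm) (rename σ G)) :
    cherednikSq a G = C (∑ i, (a * η i - sortRank (η ∘ σ.symm) (σ i)) ^ 2) * G := by
  refine rename_injective σ σ.injective ?_
  rw [rename_cherednikSq, h.cherednikSq_eq, map_mul, rename_C, ← Equiv.sum_comp σ]
  simp only [Function.comp_apply, Equiv.symm_apply_apply]

lemma excess_equivMapDomain (t : ℕ) (σ : Equiv.Perm (Fin n)) (κ : Fin n →₀ ℕ) :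
    excess t (Finsupp.equivMapDomain σ κ) = excess t κ :=
  excess_comp_equiv t κ σ.symm

lemma IsCherednikEigen.excess_le_of_rename [IsDomain R] [CharZero R]
    {G : MvPolynomial (Fin n) (Polynomial R)}
    (h : IsCherednikEigen Polynomial.X (η ∘ σ.symm) (rename σ G)) (t : ℕ) {κ : Fin n →₀ ℕ}
    (hκ : coeff κ G ≠ 0) : excess t κ ≤ excess t η := by
  have hσκ : coeff (Finsupp.equivMapDomain σ κ) (rename σ G) ≠ 0 := by
    rwa [coeff_rename_perm, ← Finsupp.equivMapDomain_trans, Equiv.self_trans_symm,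
      Finsupp.equivMapDomain_refl]
  calc excess t κ = excess t (Finsupp.equivMapDomain σ κ) := (excess_equivMapDomain t σ κ).symm
    _ ≤ excess t (η ∘ σ.symm) := h.excess_le t hσκ
    _ = excess t η := excess_comp_equiv t η σ.symm

end Conjugation

section Symmetrization

variable {n m : ℕ} {R : Type*} [CommRing R]

/-- A permutation extending an injection of the first `m` indices. -/
noncomputable def extendPerm (e : {i : Fin n // (i : ℕ) < m} ↪ Fin n) : Equiv.Perm (Fin n) := by
  classical exact (Equiv.ofInjective e e.injective).extendSubtype

lemma extendPerm_apply (e : {i : Fin n // (i : ℕ) < m} ↪ Fin n) {i : Fin n} (hi : (i : ℕ) < m) :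
    extendPerm e i = e ⟨i, hi⟩ := by
  classical
  rw [extendPerm, Equiv.extendSubtype_apply_of_mem _ i hi]
  rfl

/-- The symmetrization of a polynomial which is symmetric in the variables from the `m`-th one on.
Summing over the placements of the first `m` variables only, instead of over all permutations,
avoids a division by `(n - m)!`. -/
noncomputable def symmetrize (m : ℕ) (G : MvPolynomial (Fin n) R) : MvPolynomial (Fin n) R :=
  ∑ e : {i : Fin n // (i : ℕ) < m} ↪ Fin n, rename (extendPerm e) G

lemma isSymmetric_symmetrize {G : MvPolynomial (Fin n) R} (hG : IsSymmetricFrom m G) :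
    (symmetrize m G).IsSymmetric := fun π => by
  rw [symmetrize, map_sum]
  refine Fintype.sum_equiv (Equiv.embeddingCongr (Equiv.refl _) π) _ _ fun e => ?_
  set e' := Equiv.embeddingCongr (Equiv.refl _) π e with he'
  have hfix := hG ((extendPerm e')⁻¹ * (π * extendPerm e)) fun i hi => by
    rw [Equiv.Perm.mul_apply, Equiv.Perm.inv_eq_iff_eq, Equiv.Perm.mul_apply,
      extendPerm_apply _ hi, extendPerm_apply _ hi, he']
    simp [Equiv.embeddingCongr]
  conv_rhs => rw [← hfix]
  rw [← rename_perm_mul, ← rename_perm_mul, mul_inv_cancel_left]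

lemma isHomogeneous_symmetrize {G : MvPolynomial (Fin n) R} {N : ℕ} (hG : G.IsHomogeneous N) :
    (symmetrize m G).IsHomogeneous N :=
  IsHomogeneous.sum _ _ _ fun _ _ => hG.rename_isHomogeneous

lemma cherednikSq_symmetrize {a c : R} {G : MvPolynomial (Fin n) R}
    (hG : cherednikSq a G = C c * G) : cherednikSq a (symmetrize m G) = C c * symmetrize m G := by
  rw [symmetrize, map_sum, Finset.mul_sum]
  refine Finset.sum_congr rfl fun e _ => ?_
  rw [← rename_cherednikSq, hG, map_mul, rename_C]

lemma exists_coeff_ne_zero_of_coeff_symmetrize_ne_zero {G : MvPolynomial (Fin n) R}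
    {κ : Fin n →₀ ℕ} (h : coeff κ (symmetrize m G) ≠ 0) :
    ∃ σ : Equiv.Perm (Fin n), coeff (Finsupp.equivMapDomain σ κ) G ≠ 0 := by
  rw [symmetrize, coeff_sum] at h
  obtain ⟨e, -, he⟩ := Finset.exists_ne_zero_of_sum_ne_zero h
  rw [coeff_rename_perm] at he
  exact ⟨_, he⟩

lemma card_filter_embedding {K V : Type*} [Fintype K] [Fintype V] [DecidableEq V]
    (T : Finset V) :
    (Finset.univ.filter fun e : K ↪ V => ∀ k, e k ∈ T).card =
      T.card.descFactorial (Fintype.card K) := by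
  classical
  rw [← Fintype.card_coe T, ← Fintype.card_embedding_eq, ← Fintype.card_subtype]
  refine Fintype.card_congr
    { toFun := fun e => ⟨fun k => ⟨e.1 k, e.2 k⟩, fun k l h => e.1.injective (by simpa using h)⟩
      invFun := fun f => ⟨f.trans (Function.Embedding.subtype _), fun k => (f k).2⟩
      left_inv := fun _ => rfl
      right_inv := fun _ => rfl }

lemma isSymmetricFrom_monomial_initialExp :
    IsSymmetricFrom m (monomial (initialExp n m) (1 : R)) := fun σ hσ => by
  rw [rename_monomial]
  congr 2
  ext i
  obtain ⟨i, rfl⟩ := σ.surjective i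
  rw [Finsupp.mapDomain_apply σ.injective, initialExp_apply, initialExp_apply]
  rcases lt_or_ge (i : ℕ) m with hi | hi
  · rw [hσ i hi]
  · rw [if_neg hi.not_gt, if_neg (le_perm_apply hσ hi).not_gt]

lemma initialExp_le_equivMapDomain_iff {d : Fin n →₀ ℕ}
    (e : {i : Fin n // (i : ℕ) < m} ↪ Fin n) :
    initialExp n m ≤ Finsupp.equivMapDomain (extendPerm e).symm d ↔ ∀ k, e k ∈ d.support := by
  simp only [Finsupp.le_def, Finsupp.equivMapDomain_apply, Equiv.symm_symm, initialExp_apply,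
    Finsupp.mem_support_iff, ← Nat.one_le_iff_ne_zero]
  constructor
  · intro h k
    simpa only [if_pos k.2, extendPerm_apply e k.2] using h k
  · intro h i
    split_ifs with hi
    · rw [extendPerm_apply e hi]
      exact h _
    · exact Nat.zero_le _

variable {N : ℕ} {F : MvPolynomial (Fin n) R} {d : Fin n →₀ ℕ}

lemma coeff_rename_extendPerm (hm : m ≤ n) (hF : IsNormalizedFrom m N F) (hd : ∀ i, d i ≤ 1)
    (hdeg : d.degree = N + m) (e : {i : Fin n // (i : ℕ) < m} ↪ Fin n) :
    coeff d (rename (extendPerm e) (monomial (initialExp n m) 1 * F)) =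
      if ∀ k, e k ∈ d.support then (N.factorial : R) else 0 := by
  rw [coeff_rename_perm, coeff_monomial_mul']
  set d' := Finsupp.equivMapDomain (extendPerm e).symm d
  refine if_ctx_congr (initialExp_le_equivMapDomain_iff e) (fun hsub => ?_) fun _ => rfl
  have hle : initialExp n m ≤ d' := (initialExp_le_equivMapDomain_iff e).mpr hsub
  have hd' (i : Fin n) : d' i ≤ 1 := hd _
  rw [one_mul]
  refine hF _ (fun i => (Nat.sub_le _ _).trans (hd' i)) (fun i hi => ?_) ?_
  · rw [Finsupp.tsub_apply, initialExp_apply, if_pos hi]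
    exact Nat.sub_eq_zero_of_le (hd' i)
  · have hdeg' : d'.degree = N + m := by
      rw [← hdeg, Finsupp.degree_eq_sum, Finsupp.degree_eq_sum]
      exact Equiv.sum_comp (extendPerm e) d
    rw [← tsub_add_cancel_of_le hle, map_add, degree_initialExp hm] at hdeg'
    exact Nat.add_right_cancel hdeg'

lemma card_support_eq_degree {ι : Type*} {d : ι →₀ ℕ} (hd : ∀ i, d i ≤ 1) :
    d.support.card = d.degree := by
  rw [Finset.card_eq_sum_ones]
  refine Finset.sum_congr rfl fun i hi => ?_
  have := Finsupp.mem_support_iff.mp hi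
  have := hd i
  omega

lemma coeff_symmetrize (hm : m ≤ n) (hF : IsNormalizedFrom m N F) (hd : ∀ i, d i ≤ 1)
    (hdeg : d.degree = N + m) :
    coeff d (symmetrize m (monomial (initialExp n m) 1 * F)) = ((N + m).factorial : R) := by
  have hcard : Fintype.card {i : Fin n // (i : ℕ) < m} = m := by
    rw [Fintype.card_subtype, Fin.card_filter_val_lt, min_eq_right hm]
  rw [symmetrize, coeff_sum,
    Finset.sum_congr rfl fun e _ => coeff_rename_extendPerm hm hF hd hdeg e, ← Finset.sum_filter,
    Finset.sum_const, card_filter_embedding, card_support_eq_degree hd, hdeg, hcard, nsmul_eq_mul,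
    ← Nat.cast_mul, mul_comm]
  congr 1
  simpa using Nat.factorial_mul_descFactorial (Nat.le_add_left m N)

end Symmetrization

section SymmetricJack

variable {n N : ℕ}

/-- The eigenvalue of the sum of the squares of the Cherednik operators on the symmetric Jack
polynomial of index `lam`. -/
noncomputable def jackEigenvalue (n : ℕ) (lam : N.Partition) : Polynomial ℤ :=
  ∑ i : Fin n, (Polynomial.X * (part lam i : Polynomial ℤ) - ((i : ℕ) : Polynomial ℤ)) ^ 2

lemma coeff_one_jackEigenvalue (n : ℕ) (lam : N.Partition) :
    (jackEigenvalue n lam).coeff 1 = -2 * ((∑ i ∈ Finset.range n, i * part lam i : ℕ) : ℤ) := by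
  have hcoeff (b c : ℕ) :
      ((Polynomial.X * (b : Polynomial ℤ) - (c : Polynomial ℤ)) ^ 2).coeff 1 =
        -2 * ((c * b : ℕ) : ℤ) := by
    have hexpand : (Polynomial.X * (b : Polynomial ℤ) - (c : Polynomial ℤ)) ^ 2 =
        Polynomial.C ((b : ℤ) ^ 2) * Polynomial.X ^ 2 +
        Polynomial.C (-2 * ((c * b : ℕ) : ℤ)) * Polynomial.X + Polynomial.C ((c : ℤ) ^ 2) := by
      simp only [Polynomial.C_mul, Polynomial.C_pow, Polynomial.C_neg, map_natCast, map_ofNat,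
        Nat.cast_mul]
      ring
    rw [hexpand, Polynomial.coeff_add, Polynomial.coeff_add, Polynomial.coeff_C_mul_X_pow,
      Polynomial.coeff_C_mul, Polynomial.coeff_X_one, Polynomial.coeff_C_of_ne_zero one_ne_zero]
    simp
  rw [jackEigenvalue, Polynomial.finsetSum_coeff, Nat.cast_sum, Finset.mul_sum,
    Finset.sum_range]
  exact Finset.sum_congr rfl fun i _ => hcoeff _ _

lemma eq_of_domLE_of_jackEigenvalue_eq (hN : N ≤ n) {lam mu : N.Partition} (hle : DomLE mu lam)
    (h : jackEigenvalue n lam = jackEigenvalue n mu) : mu = lam := by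
  have hcoeff := congrArg (Polynomial.coeff · 1) h
  simp only [coeff_one_jackEigenvalue] at hcoeff
  exact eq_of_domLE_of_sum_mul_part_eq hle ((card_parts_le lam).trans hN)
    ((card_parts_le mu).trans hN) (by omega)

/-- `S` is an integral form of the symmetric Jack polynomial of index `lam`: it is triangular in
dominance order, its coefficient of `m_{1^N}` is `N!`, and it is an eigenfunction of the sum of
the squares of the Cherednik operators. -/
structure IsIntegralSymmetricJack (lam : N.Partition)
    (S : MvPolynomial (Fin n) (Polynomial ℤ)) : Prop where
  isSymmetric : S.IsSymmetric
  isHomogeneous : S.IsHomogeneous N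
  coeff_eq_factorial : ∀ d : Fin n →₀ ℕ, (∀ i, d i ≤ 1) → d.degree = N → coeff d S = N.factorial
  domLE : ∀ (κ : Fin n →₀ ℕ) (mu : N.Partition), vals κ = mu.parts → coeff κ S ≠ 0 → DomLE mu lam
  eigen : cherednikSq Polynomial.X S = C (jackEigenvalue n lam) * S

lemma exists_isCherednikEigen_rotate (hN : N ≤ n + 1) (lam : N.Partition) :
    ∃ (M : ℕ) (F : MvPolynomial (Fin (n + 1)) (Polynomial ℤ)), M + len lam = N ∧
      F.IsHomogeneous M ∧ IsSymmetricFrom (len lam) F ∧ IsNormalizedFrom (len lam) M F ∧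
      IsCherednikEigen Polynomial.X
        ((fun i : Fin (n + 1) => part lam i) ∘ (rotation n ^ len lam).symm)
        (rename (rotation n ^ len lam) (monomial (initialExp (n + 1) (len lam)) 1 * F)) := by
  have hlen : len lam ≤ n + 1 := (card_parts_le lam).trans hN
  set ν : Fin (n + 1) → ℕ := fun i => part lam i - 1
  have hν : ν + ⇑(initialExp (n + 1) (len lam)) = fun i : Fin (n + 1) => part lam i := by
    funext i
    rw [Pi.add_apply, initialExp_apply]
    split_ifs with hi
    · exact Nat.sub_add_cancel (part_pos hi)
    · simp [ν, part_eq_zero (not_lt.mp hi)]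
  have hsum : ∑ i, ν i + len lam = N := by
    have hpart := sum_part lam hlen
    rw [Finset.sum_range, ← Finset.sum_congr rfl fun i _ => congrFun hν i] at hpart
    simp only [Pi.add_apply] at hpart
    rwa [Finset.sum_add_distrib, ← Finsupp.degree_eq_sum, degree_initialExp hlen] at hpart
  obtain ⟨F, hF⟩ := exists_isIntegralJack (len lam) ν fun j hj => by simp [ν, part_eq_zero hj]
  exact ⟨_, F, hsum, hF.homogeneous, hF.symm, hF.normalized, hν ▸ hF.eigen.rotate hlen⟩

lemma cherednikSq_eq_jackEigenvalue (hN : N ≤ n + 1) {lam : N.Partition}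
    {G : MvPolynomial (Fin (n + 1)) (Polynomial ℤ)}
    (hG : IsCherednikEigen Polynomial.X
      ((fun i : Fin (n + 1) => part lam i) ∘ (rotation n ^ len lam).symm)
      (rename (rotation n ^ len lam) G)) :
    cherednikSq Polynomial.X G = C (jackEigenvalue (n + 1) lam) * G := by
  have hpos (i : Fin (n + 1)) : 0 < part lam i ↔ (i : ℕ) < len lam :=
    ⟨fun h => not_le.mp fun hi => h.ne' (part_eq_zero hi), part_pos⟩
  have hanti : Antitone fun i : Fin (n + 1) => part lam i := fun i j h => part_antitone lam h
  rw [hG.cherednikSq_eq_of_rename, jackEigenvalue]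
  congr! 6 with i
  exact sortRank_comp_rotation_pow hanti ((card_parts_le lam).trans hN) hpos i

theorem exists_isIntegralSymmetricJack (hN : N ≤ n + 1) (lam : N.Partition) :
    ∃ S : MvPolynomial (Fin (n + 1)) (Polynomial ℤ), IsIntegralSymmetricJack lam S := by
  have hlen : len lam ≤ n + 1 := (card_parts_le lam).trans hN
  obtain ⟨M, F, hM, hhom, hsymm, hnorm, heigen⟩ := exists_isCherednikEigen_rotate hN lam
  refine ⟨symmetrize (len lam) (monomial (initialExp (n + 1) (len lam)) 1 * F),
    ⟨isSymmetric_symmetrize fun σ hσ => ?_, isHomogeneous_symmetrize ?_, fun d hd hdeg => ?_,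
      fun κ mu hκ hne => domLE_of_sum_tsub_le fun t => ?_,
      cherednikSq_symmetrize (cherednikSq_eq_jackEigenvalue hN heigen)⟩⟩
  · rw [map_mul, isSymmetricFrom_monomial_initialExp σ hσ, hsymm σ hσ]
  · have hprod := (isHomogeneous_monomial (1 : Polynomial ℤ) (degree_initialExp hlen)).mul hhom
    rwa [add_comm (len lam), hM] at hprod
  · rw [coeff_symmetrize hlen hnorm hd (hdeg.trans hM.symm), hM]
  · obtain ⟨σ, hσ⟩ := exists_coeff_ne_zero_of_coeff_symmetrize_ne_zero hne
    rw [← excess_eq_of_vals_eq hκ, ← excess_part lam hlen, ← excess_equivMapDomain t σ κ]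
    exact heigen.excess_le_of_rename t hσ

end SymmetricJack

section SymmetricFactor

variable {n : ℕ} {R : Type*} [CommRing R]

lemma euler_X_pow {ι : Type*} (i : ι) (k : ℕ) :
    euler i (X i ^ k : MvPolynomial ι R) = (k : MvPolynomial ι R) * X i ^ k := by
  induction k with
  | zero => simp [euler_apply]
  | succ k ih => rw [pow_succ, euler_mul, ih, euler_X_self]; push_cast; ring

lemma euler_psum {ι : Type*} [Fintype ι] (i : ι) (k : ℕ) :
    euler i (psum ι R k) = (k : MvPolynomial ι R) * X i ^ k := by
  classical
  rw [psum, map_sum, Finset.sum_eq_single i, euler_X_pow]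
  · intro j _ hj
    rw [euler_apply, pderiv_pow, pderiv_X_of_ne hj, mul_zero, mul_zero]
  · simp

lemma cherednik_mul_of_isSymmetric (a : R) (i : Fin n) {s : MvPolynomial (Fin n) R}
    (hs : s.IsSymmetric) (f : MvPolynomial (Fin n) R) :
    cherednik a i (s * f) = s * cherednik a i f + C a * euler i s * f := by
  simp only [cherednik_apply, euler_mul, divDiff_mul_of_rename_swap_eq (hs _), mul_add, mul_sub,
    Finset.mul_sum, mul_left_comm _ s]
  ring

lemma cherednik_of_isSymmetric (a : R) (i : Fin n) {s : MvPolynomial (Fin n) R}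
    (hs : s.IsSymmetric) :
    cherednik a i s = C a * euler i s - ((i : ℕ) : MvPolynomial (Fin n) R) * s := by
  rw [cherednik_apply, Finset.sum_eq_zero fun j _ => by rw [divDiff_eq_zero i j (hs _), mul_zero],
    add_zero]

end SymmetricFactor

section CherednikPower

variable {n : ℕ} {R : Type*} [CommRing R]

lemma X_left_mul_divDiff_X_pow {ι : Type*} [DecidableEq ι] {i j : ι} (h : i ≠ j) (m : ℕ) :
    X i * divDiff i j (X i ^ (m + 1) : MvPolynomial ι R) =
      ∑ u ∈ Finset.range m, X i ^ (u + 1) * X j ^ (m - u) + X i ^ (m + 1) := by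
  rw [divDiff_X_pow h, Finset.mul_sum, Finset.sum_range_succ, Nat.add_sub_cancel, Nat.sub_self,
    pow_zero, mul_one, ← pow_succ']
  simp only [← mul_assoc, ← pow_succ']

lemma X_right_mul_divDiff_X_pow {ι : Type*} [DecidableEq ι] {i j : ι} (h : i ≠ j) (m : ℕ) :
    X j * divDiff i j (X i ^ (m + 1) : MvPolynomial ι R) =
      ∑ u ∈ Finset.range m, X i ^ (u + 1) * X j ^ (m - u) + X j ^ (m + 1) := by
  rw [divDiff_X_pow h, Finset.mul_sum, Finset.sum_range_succ', Nat.add_sub_cancel, pow_zero,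
    one_mul, ← pow_succ', Nat.sub_zero]
  refine congrArg (· + _) (Finset.sum_congr rfl fun u hu => ?_)
  rw [mul_left_comm, ← pow_succ', ← Nat.sub_sub, Nat.sub_add_cancel (by grind)]

lemma X_max_mul_divDiff_X_pow (i j : Fin n) (m : ℕ) :
    X (max i j) * divDiff i j (X i ^ (m + 1) : MvPolynomial (Fin n) R) =
      ∑ u ∈ Finset.range m, (X i ^ (u + 1) * X j ^ (m - u) - if j = i then X i ^ (m + 1) else 0) +
      ((if j < i then X i ^ (m + 1) else 0) + if i < j then X j ^ (m + 1) else 0) := by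
  rcases lt_trichotomy i j with h | rfl | h
  · rw [max_eq_right h.le, X_right_mul_divDiff_X_pow h.ne]
    simp [h, h.ne', h.not_gt]
  · simp only [divDiff_self, mul_zero, lt_irrefl, if_false, add_zero, if_true]
    refine (Finset.sum_eq_zero fun u hu => ?_).symm
    rw [← pow_add, show u + 1 + (m - u) = m + 1 by grind, sub_self]
  · rw [max_eq_left h.le, X_left_mul_divDiff_X_pow h.ne']
    simp [h, h.ne, h.not_gt]

lemma sum_X_max_mul_divDiff_X_pow (m : ℕ) :
    ∑ i : Fin n, ∑ j, X (max i j) * divDiff i j (X i ^ (m + 1) : MvPolynomial (Fin n) R) =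
      ∑ u ∈ Finset.range m, (psum (Fin n) R (u + 1) * psum (Fin n) R (m - u)
        - psum (Fin n) R (m + 1)) +
      2 * ∑ i : Fin n, ((i : ℕ) : MvPolynomial (Fin n) R) * X i ^ (m + 1) := by
  have hcount (i : Fin n) : ∑ j : Fin n, (if j < i then X i ^ (m + 1) else 0) =
      ((i : ℕ) : MvPolynomial (Fin n) R) * X i ^ (m + 1) := by
    rw [← Finset.sum_filter, Finset.sum_const, nsmul_eq_mul, Finset.filter_gt_eq_Iio, Fin.card_Iio]
  simp only [X_max_mul_divDiff_X_pow, Finset.sum_add_distrib, two_mul]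
  refine congrArg₂ _ ?_ (congrArg₂ _ (Finset.sum_congr rfl fun i _ => hcount i) ?_)
  · rw [Finset.sum_congr rfl fun i _ => Finset.sum_comm, Finset.sum_comm]
    refine Finset.sum_congr rfl fun u _ => ?_
    simp only [Finset.sum_sub_distrib, Finset.sum_ite_eq', Finset.mem_univ, if_true]
    rw [psum, psum, psum, Finset.sum_mul_sum]
  · rw [Finset.sum_comm]
    exact Finset.sum_congr rfl fun i _ => hcount i

lemma sum_cherednik_X_pow (a : R) (m : ℕ) :
    ∑ i : Fin n, cherednik a i (X i ^ (m + 1)) =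
      C (a * ((m + 1 : ℕ) : R) - m) * psum (Fin n) R (m + 1) +
      ∑ u ∈ Finset.range m, psum (Fin n) R (u + 1) * psum (Fin n) R (m - u) +
      ∑ i : Fin n, ((i : ℕ) : MvPolynomial (Fin n) R) * X i ^ (m + 1) := by
  have heuler : ∑ i : Fin n, C a * euler i (X i ^ (m + 1)) =
      C (a * ((m + 1 : ℕ) : R)) * psum (Fin n) R (m + 1) := by
    simp only [euler_X_pow, psum, Finset.mul_sum, C_mul, map_natCast, mul_assoc]
  simp only [cherednik_apply, Finset.sum_sub_distrib, Finset.sum_add_distrib, heuler,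
    sum_X_max_mul_divDiff_X_pow, Finset.sum_const, Finset.card_range, nsmul_eq_mul, C_sub,
    map_natCast]
  ring

end CherednikPower

section PowerSumHom

variable {n N : ℕ} {R : Type*} [CommRing R] (a : R)

/-- The substitution of the power sum of degree `b + 1` for the `b`-th variable. Under it,
polynomials in `N` variables represent symmetric polynomials. -/
noncomputable def psumAlgHom (n N : ℕ) (R : Type*) [CommRing R] :
    MvPolynomial (Fin N) R →ₐ[R] MvPolynomial (Fin n) R :=
  aeval fun b => psum (Fin n) R (b + 1)

lemma psumAlgHom_X (b : Fin N) : psumAlgHom n N R (X b) = psum (Fin n) R (b + 1) :=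
  aeval_X _ b

lemma psumAlgHom_C (c : R) : psumAlgHom n N R (C c) = C c := aeval_C _ c

lemma isSymmetric_psumAlgHom (g : MvPolynomial (Fin N) R) : (psumAlgHom n N R g).IsSymmetric := by
  induction g using MvPolynomial.induction_on with
  | C c => rw [psumAlgHom_C]; exact .C c
  | add p q hp hq => rw [map_add]; exact hp.add hq
  | mul_X p b hp => rw [map_mul, psumAlgHom_X]; exact hp.mul (psum_isSymmetric _ _ _)

/-- The derivation `p_{b+1}^⊥ = a (b + 1) ∂/∂p_{b+1}` of polynomials in the power sums; it is
adjoint to the multiplication by `p_{b+1}`. -/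
noncomputable def powerSumAdjoint (b : Fin N) : Module.End R (MvPolynomial (Fin N) R) :=
  (a * ((b + 1 : ℕ) : R)) • (pderiv b).toLinearMap

lemma powerSumAdjoint_apply (b : Fin N) (f : MvPolynomial (Fin N) R) :
    powerSumAdjoint a b f = C (a * ((b + 1 : ℕ) : R)) * pderiv b f :=
  smul_eq_C_mul _ _

lemma powerSumAdjoint_mul_X (b c : Fin N) (f : MvPolynomial (Fin N) R) :
    powerSumAdjoint a b (f * X c) =
      powerSumAdjoint a b f * X c + if b = c then C (a * ((c + 1 : ℕ) : R)) * f else 0 := by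
  rw [powerSumAdjoint_apply, powerSumAdjoint_apply, pderiv_mul, pderiv_X]
  split_ifs with h
  · subst h
    rw [Pi.single_eq_same]
    ring
  · rw [Pi.single_eq_of_ne (Ne.symm h)]
    ring

lemma C_mul_euler_psumAlgHom (i : Fin n) (g : MvPolynomial (Fin N) R) :
    C a * euler i (psumAlgHom n N R g) =
      ∑ b : Fin N, psumAlgHom n N R (powerSumAdjoint a b g) * X i ^ (b + 1 : ℕ) := by
  induction g using MvPolynomial.induction_on with
  | C c => simp [euler_apply, powerSumAdjoint_apply]
  | add p q hp hq => simp only [map_add, mul_add, hp, hq, add_mul, Finset.sum_add_distrib]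
  | mul_X p c hp =>
    have hstep (b : Fin N) :
        psumAlgHom n N R (powerSumAdjoint a b (p * X c)) * X i ^ (b + 1 : ℕ) =
          psumAlgHom n N R (powerSumAdjoint a b p) * X i ^ (b + 1 : ℕ) * psum (Fin n) R (c + 1) +
          if b = c then C (a * ((c + 1 : ℕ) : R)) * psumAlgHom n N R p * X i ^ (c + 1 : ℕ)
          else 0 := by
      rw [powerSumAdjoint_mul_X, map_add, map_mul, psumAlgHom_X]
      split_ifs with h
      · rw [map_mul, psumAlgHom_C, h]
        ring
      · rw [map_zero]
        ring
    simp only [hstep, Finset.sum_add_distrib, Finset.sum_ite_eq', Finset.mem_univ, if_true,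
      ← Finset.sum_mul, ← hp]
    rw [map_mul, euler_mul, psumAlgHom_X, euler_psum, C_mul, map_natCast]
    ring

lemma cherednik_psumAlgHom_mul_X_pow (i : Fin n) (g : MvPolynomial (Fin N) R) (k : ℕ) :
    cherednik a i (psumAlgHom n N R g * X i ^ k) =
      psumAlgHom n N R g * cherednik a i (X i ^ k) +
        ∑ c : Fin N, psumAlgHom n N R (powerSumAdjoint a c g) * X i ^ (k + (c + 1)) := by
  rw [cherednik_mul_of_isSymmetric a i (isSymmetric_psumAlgHom g), C_mul_euler_psumAlgHom,
    Finset.sum_mul]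
  simp only [mul_assoc, ← pow_add, add_comm k]

lemma cherednik_cherednik_psumAlgHom (i : Fin n) (g : MvPolynomial (Fin N) R) :
    cherednik a i (cherednik a i (psumAlgHom n N R g)) =
      ∑ b : Fin N, psumAlgHom n N R (powerSumAdjoint a b g) * (cherednik a i (X i ^ (b + 1 : ℕ)) -
        ((i : ℕ) : MvPolynomial (Fin n) R) * X i ^ (b + 1 : ℕ)) +
      ∑ b : Fin N, ∑ c : Fin N, psumAlgHom n N R (powerSumAdjoint a c (powerSumAdjoint a b g)) *
        X i ^ (b + 1 + (c + 1) : ℕ) +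
      ((i : ℕ) : MvPolynomial (Fin n) R) ^ 2 * psumAlgHom n N R g := by
  have hfirst : cherednik a i (psumAlgHom n N R g) =
      ∑ b : Fin N, psumAlgHom n N R (powerSumAdjoint a b g) * X i ^ (b + 1 : ℕ) -
        C ((i : ℕ) : R) * psumAlgHom n N R g := by
    rw [cherednik_of_isSymmetric a i (isSymmetric_psumAlgHom g), C_mul_euler_psumAlgHom,
      map_natCast]
  rw [hfirst, map_sub, cherednik_C_mul, hfirst, map_sum]
  simp only [cherednik_psumAlgHom_mul_X_pow, Finset.sum_add_distrib, mul_sub, Finset.mul_sum,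
    Finset.sum_sub_distrib, map_natCast, mul_left_comm ((i : ℕ) : MvPolynomial (Fin n) R)]
  ring

lemma cherednikSq_psumAlgHom (g : MvPolynomial (Fin N) R) :
    cherednikSq a (psumAlgHom n N R g) =
      ∑ b : Fin N, psumAlgHom n N R (powerSumAdjoint a b g) *
        (C (a * ((b + 1 : ℕ) : R) - ((b : ℕ) : R)) * psum (Fin n) R (b + 1) +
          ∑ u ∈ Finset.range b, psum (Fin n) R (u + 1) * psum (Fin n) R (b - u)) +
      ∑ b : Fin N, ∑ c : Fin N, psumAlgHom n N R (powerSumAdjoint a c (powerSumAdjoint a b g)) *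
        psum (Fin n) R (b + 1 + (c + 1)) +
      (∑ i : Fin n, ((i : ℕ) : MvPolynomial (Fin n) R) ^ 2) * psumAlgHom n N R g := by
  simp only [cherednikSq_apply, cherednik_cherednik_psumAlgHom, Finset.sum_add_distrib,
    Finset.sum_mul]
  refine congrArg₂ _ (congrArg₂ _ ?_ ?_) rfl
  · rw [Finset.sum_comm]
    refine Finset.sum_congr rfl fun b _ => ?_
    rw [← Finset.mul_sum, Finset.sum_sub_distrib, sum_cherednik_X_pow, add_sub_cancel_right]
  · rw [Finset.sum_comm]
    refine Finset.sum_congr rfl fun b _ => ?_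
    rw [Finset.sum_comm]
    exact Finset.sum_congr rfl fun c _ => by rw [psum, Finset.mul_sum]

end PowerSumHom

section PowerSumForm

variable {N : ℕ} {R : Type*} [CommRing R] (a : R)

/-- The squared norm of the monomial `∏ p_{b+1} ^ u b` in the power sums. -/
noncomputable def powerSumNormSq (u : Fin N →₀ ℕ) : R :=
  ∏ b : Fin N, ((u b).factorial : R) * (a * ((b + 1 : ℕ) : R)) ^ u b

lemma powerSumNormSq_add_single (u : Fin N →₀ ℕ) (b : Fin N) :
    powerSumNormSq a (u + Finsupp.single b 1) =
      powerSumNormSq a u * ((u b : R) + 1) * (a * ((b + 1 : ℕ) : R)) := by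
  have hne : ∀ c ∈ Finset.univ.erase b,
      (u + Finsupp.single b 1 : Fin N →₀ ℕ) c = u c := fun c hc => by
    simp [(Finset.ne_of_mem_erase hc).symm]
  unfold powerSumNormSq
  rw [← Finset.mul_prod_erase _ _ (Finset.mem_univ b),
    ← Finset.mul_prod_erase _ (fun b => ((u b).factorial : R) * _) (Finset.mem_univ b),
    Finset.prod_congr rfl fun c hc => by rw [hne c hc], Finsupp.add_apply, Finsupp.single_eq_same,
    Nat.factorial_succ, pow_succ]
  push_cast
  ring

/-- The symmetric bilinear form on polynomials in the power sums for which the monomials are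
orthogonal with squared norms `powerSumNormSq`. It represents the Jack scalar product. -/
noncomputable def powerSumForm : LinearMap.BilinForm R (MvPolynomial (Fin N) R) :=
  (basisMonomials (Fin N) R).constr R fun u => powerSumNormSq a u • lcoeff R u

lemma powerSumForm_monomial (u : Fin N →₀ ℕ) (c : R) (g : MvPolynomial (Fin N) R) :
    powerSumForm a (monomial u c) g = c * (powerSumNormSq a u * coeff u g) := by
  have hu : monomial u c = c • basisMonomials (Fin N) R u := by simp [smul_monomial]
  rw [hu, map_smul, powerSumForm, Module.Basis.constr_basis]
  simp

lemma powerSumForm_comm (f g : MvPolynomial (Fin N) R) :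
    powerSumForm a f g = powerSumForm a g f := by
  induction f using MvPolynomial.induction_on' with
  | add p q hp hq => rw [map_add, map_add, LinearMap.add_apply, hp, hq]
  | monomial u c =>
    induction g using MvPolynomial.induction_on' with
    | add p q hp hq => rw [map_add, map_add, LinearMap.add_apply, hp, hq]
    | monomial v d =>
      rw [powerSumForm_monomial, powerSumForm_monomial, coeff_monomial, coeff_monomial]
      by_cases h : u = v
      · subst h
        simp only [if_true]
        ring
      · rw [if_neg h, if_neg (Ne.symm h)]
        simp only [mul_zero]

lemma isAdjointPair_mulLeft_powerSumAdjoint (b : Fin N) :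
    LinearMap.IsAdjointPair (powerSumForm a) (powerSumForm a)
      (LinearMap.mulLeft R (X b)) (powerSumAdjoint a b) := fun f g => by
  induction f using MvPolynomial.induction_on' with
  | add p q hp hq => simp only [map_add, LinearMap.add_apply, hp, hq]
  | monomial u c =>
    rw [LinearMap.mulLeft_apply, X, monomial_mul, one_mul, add_comm, powerSumForm_monomial,
      powerSumForm_monomial, powerSumAdjoint_apply, coeff_C_mul, coeff_pderiv,
      powerSumNormSq_add_single]
    ring

lemma isAdjointPair_powerSumAdjoint_mulLeft (b : Fin N) :
    LinearMap.IsAdjointPair (powerSumForm a) (powerSumForm a)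
      (powerSumAdjoint a b) (LinearMap.mulLeft R (X b)) := fun f g => by
  rw [powerSumForm_comm, ← isAdjointPair_mulLeft_powerSumAdjoint, powerSumForm_comm]

/-- The sum of the operator replacing a product `p_{b+1} p_{c+1}` by `p_{e+1}` and of the
opposite operator, replacing `p_{e+1}` by `p_{b+1} p_{c+1}`. -/
noncomputable def mergeSplit (b c e : Fin N) : Module.End R (MvPolynomial (Fin N) R) :=
  LinearMap.mulLeft R (X e) * (powerSumAdjoint a c * powerSumAdjoint a b) +
    LinearMap.mulLeft R (X b) * LinearMap.mulLeft R (X c) * powerSumAdjoint a e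

lemma isSelfAdjoint_mergeSplit (b c e : Fin N) :
    (powerSumForm a).IsSelfAdjoint (mergeSplit a b c e) := fun f g => by
  have hmul := isAdjointPair_mulLeft_powerSumAdjoint (N := N) a
  have hadj := isAdjointPair_powerSumAdjoint_mulLeft (N := N) a
  have hmerge := (hmul e).mul ((hadj c).mul (hadj b)) f g
  have hsplit := ((hmul b).mul (hmul c)).mul (hadj e) f g
  rw [mergeSplit, LinearMap.add_apply, LinearMap.add_apply, map_add, map_add,
    LinearMap.add_apply, hmerge, hsplit, add_comm]

/-- The Laplace–Beltrami operator in the power sums: the operator which corresponds to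
`cherednikSq` under `psumAlgHom`, up to terms vanishing in weighted degree `N`. -/
noncomputable def laplaceBeltrami (c₀ : R) : Module.End R (MvPolynomial (Fin N) R) :=
  ∑ b : Fin N, (a * ((b + 1 : ℕ) : R) - ((b : ℕ) : R)) •
    (LinearMap.mulLeft R (X b) * powerSumAdjoint a b) +
  ∑ b : Fin N, ∑ c : Fin N, ∑ e : Fin N with Fin.val e = b + c + 1, mergeSplit a b c e +
  c₀ • 1

lemma isSelfAdjoint_laplaceBeltrami (c₀ : R) :
    (powerSumForm a).IsSelfAdjoint (laplaceBeltrami (N := N) a c₀) := by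
  rw [← LinearMap.mem_selfAdjointSubmodule]
  refine add_mem (add_mem (sum_mem fun b _ => Submodule.smul_mem _ _ ?_) (sum_mem fun b _ =>
    sum_mem fun c _ => sum_mem fun e _ => isSelfAdjoint_mergeSplit a b c e))
    (Submodule.smul_mem _ _ LinearMap.isAdjointPair_one)
  exact (isAdjointPair_mulLeft_powerSumAdjoint a b).mul (isAdjointPair_powerSumAdjoint_mulLeft a b)

end PowerSumForm

section PowerSumWeight

variable {N : ℕ} {R : Type*} [CommRing R] (a : R)

/-- The weights `b + 1` of the variables for which `psumAlgHom` is graded. -/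
def powerSumWeight (N : ℕ) (b : Fin N) : ℕ := b + 1

lemma isWeightedHomogeneous_X_mul {f : MvPolynomial (Fin N) R} {k l : ℕ}
    (hf : IsWeightedHomogeneous (powerSumWeight N) f k) (b : Fin N) (h : k + (b + 1) = l) :
    IsWeightedHomogeneous (powerSumWeight N) (X b * f) l := by
  rw [← h, add_comm]
  exact (isWeightedHomogeneous_X R (powerSumWeight N) b).mul hf

lemma isWeightedHomogeneous_powerSumAdjoint {f : MvPolynomial (Fin N) R} {k l : ℕ}
    (hf : IsWeightedHomogeneous (powerSumWeight N) f k) (b : Fin N) (h : l + (b + 1) = k) :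
    IsWeightedHomogeneous (powerSumWeight N) (powerSumAdjoint a b f) l := by
  rw [powerSumAdjoint_apply]
  exact (hf.pderiv (i := b) h).C_mul _

lemma isWeightedHomogeneous_mergeSplit {f : MvPolynomial (Fin N) R} {k : ℕ}
    (hf : IsWeightedHomogeneous (powerSumWeight N) f k) {b c e : Fin N} (h : (e : ℕ) = b + c + 1)
    (hk : (e : ℕ) + 1 ≤ k) : IsWeightedHomogeneous (powerSumWeight N) (mergeSplit a b c e f) k := by
  have hmerge := isWeightedHomogeneous_powerSumAdjoint a (isWeightedHomogeneous_powerSumAdjoint a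
    hf b (l := k - (b + 1)) (by lia)) c (l := k - (e + 1)) (by lia)
  have hsplit := isWeightedHomogeneous_powerSumAdjoint a hf e (l := k - (e + 1)) (by lia)
  exact (isWeightedHomogeneous_X_mul hmerge e (by lia)).add (isWeightedHomogeneous_X_mul
    (isWeightedHomogeneous_X_mul hsplit c (l := k - (b + 1)) (by lia)) b (by lia))

lemma isWeightedHomogeneous_laplaceBeltrami (c₀ : R) {f : MvPolynomial (Fin N) R}
    (hf : IsWeightedHomogeneous (powerSumWeight N) f N) :
    IsWeightedHomogeneous (powerSumWeight N) (laplaceBeltrami a c₀ f) N := by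
  simp only [laplaceBeltrami, LinearMap.add_apply, LinearMap.sum_apply, LinearMap.smul_apply,
    smul_eq_C_mul]
  refine ((IsWeightedHomogeneous.sum _ _ _ fun b _ => .C_mul ?_ _).add
    (.sum _ _ _ fun b _ => .sum _ _ _ fun c _ => .sum _ _ _ fun e he => ?_)).add (hf.C_mul _)
  · exact isWeightedHomogeneous_X_mul (isWeightedHomogeneous_powerSumAdjoint a hf b
      (l := N - (b + 1)) (by lia)) b (by lia)
  · exact isWeightedHomogeneous_mergeSplit a hf (Finset.mem_filter.mp he).2 e.isLt

lemma powerSumAdjoint_powerSumAdjoint_eq_zero {f : MvPolynomial (Fin N) R} {k : ℕ}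
    (hf : IsWeightedHomogeneous (powerSumWeight N) f k) {b c : Fin N} (h : k ≤ (b : ℕ) + c + 1) :
    powerSumAdjoint a c (powerSumAdjoint a b f) = 0 := by
  ext u
  have hu : coeff (u + Finsupp.single c 1 + Finsupp.single b 1) f = 0 := by
    refine hf.coeff_eq_zero _ fun hw => ?_
    simp only [map_add, Finsupp.weight_single, powerSumWeight, smul_eq_mul, one_mul] at hw
    lia
  rw [powerSumAdjoint_apply, powerSumAdjoint_apply, coeff_C_mul, coeff_pderiv, coeff_C_mul,
    coeff_pderiv, hu, coeff_zero]
  ring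

lemma sum_range_eq_sum_fin {M : Type*} [AddCommMonoid M] (e : Fin N) (h : ℕ → ℕ → M) :
    ∑ u ∈ Finset.range e, h (u + 1) (e - u) =
      ∑ b : Fin N, ∑ c : Fin N, if (e : ℕ) = b + c + 1 then h (b + 1) (c + 1) else 0 := by
  rw [← Finset.sum_product', ← Finset.sum_filter]
  refine Finset.sum_bij' (fun u hu => (⟨u, ?_⟩, ⟨e - u - 1, ?_⟩)) (fun x _ => x.1)
    ?_ ?_ ?_ ?_ ?_ <;> grind

lemma cherednikSq_psumAlgHom_eq_psumAlgHom_laplaceBeltrami {n : ℕ} {g : MvPolynomial (Fin N) R}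
    (hg : IsWeightedHomogeneous (powerSumWeight N) g N) :
    cherednikSq a (psumAlgHom n N R g) =
      psumAlgHom n N R (laplaceBeltrami a (∑ i : Fin n, ((i : ℕ) : R) ^ 2) g) := by
  have hmerge (b c : Fin N) :
      psumAlgHom n N R (powerSumAdjoint a c (powerSumAdjoint a b g)) *
        psum (Fin n) R (b + 1 + (c + 1)) =
      ∑ e : Fin N with Fin.val e = b + c + 1, psum (Fin n) R (e + 1) *
        psumAlgHom n N R (powerSumAdjoint a c (powerSumAdjoint a b g)) := by
    rw [← Finset.sum_mul, mul_comm]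
    by_cases h : (b : ℕ) + c + 1 < N
    · rw [show ({e : Fin N | Fin.val e = b + c + 1} : Finset (Fin N)) = {⟨b + c + 1, h⟩} by grind,
        Finset.sum_singleton, show (b : ℕ) + 1 + (c + 1) = b + c + 1 + 1 by lia]
    · rw [powerSumAdjoint_powerSumAdjoint_eq_zero a hg (not_lt.mp h), map_zero, mul_zero, mul_zero]
  have hsplit :
      ∑ e : Fin N, psumAlgHom n N R (powerSumAdjoint a e g) *
        ∑ u ∈ Finset.range e, psum (Fin n) R (u + 1) * psum (Fin n) R (e - u) =
      ∑ b : Fin N, ∑ c : Fin N, ∑ e : Fin N with Fin.val e = b + c + 1,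
        psum (Fin n) R (b + 1) * (psum (Fin n) R (c + 1) *
          psumAlgHom n N R (powerSumAdjoint a e g)) := by
    simp only [sum_range_eq_sum_fin _ fun x y => psum (Fin n) R x * psum (Fin n) R y,
      Finset.mul_sum, mul_ite, mul_zero, Finset.sum_filter]
    rw [Finset.sum_comm]
    refine Finset.sum_congr rfl fun b _ => ?_
    rw [Finset.sum_comm]
    simp only [← mul_assoc, mul_comm (psumAlgHom n N R _)]
  rw [cherednikSq_psumAlgHom]
  simp only [mul_add, Finset.sum_add_distrib, hmerge, hsplit]
  simp only [laplaceBeltrami, mergeSplit, LinearMap.add_apply, LinearMap.sum_apply,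
    LinearMap.smul_apply, Module.End.mul_apply, Module.End.one_apply, LinearMap.mulLeft_apply,
    map_add, map_sum, map_mul, psumAlgHom_X, smul_eq_C_mul, psumAlgHom_C, map_pow, map_natCast,
    Finset.sum_add_distrib, mul_comm (psumAlgHom n N R (powerSumAdjoint a _ g)), mul_assoc]
  abel

end PowerSumWeight

section PartitionMultiplicities

variable {N : ℕ}

@[to_additive]
lemma prod_toFinset_parts_eq_prod_fin {M : Type*} [CommMonoid M] (mu : N.Partition) (F : ℕ → M)
    (hF : ∀ k, k ∉ mu.parts → F k = 1) :
    ∏ k ∈ mu.parts.toFinset, F k = ∏ b : Fin N, F (b + 1) := by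
  have hinj : Function.Injective fun b : Fin N => (b : ℕ) + 1 := fun b c h =>
    Fin.ext (Nat.succ_injective h)
  rw [← Finset.prod_image (s := Finset.univ) (g := fun b : Fin N => (b : ℕ) + 1)
    fun b _ c _ h => hinj h]
  refine Finset.prod_subset (fun k hk => ?_) fun k _ hk => hF k (by simpa using hk)
  have hmem := Multiset.mem_toFinset.mp hk
  have hpos := mu.parts_pos hmem
  have hle := mu.parts_sum ▸ Multiset.le_sum_of_mem hmem
  exact Finset.mem_image.mpr ⟨⟨k - 1, by lia⟩, Finset.mem_univ _, Nat.sub_add_cancel hpos⟩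

/-- The multiplicities of the parts of a partition: the exponent vector of `p_μ` as a monomial
in the power sums. The variable `b` stands for the part `b + 1`. -/
noncomputable def partMultiplicities (mu : N.Partition) : Fin N →₀ ℕ :=
  Finsupp.equivFunOnFinite.symm fun b => mu.parts.count (b + 1 : ℕ)

lemma partMultiplicities_apply (mu : N.Partition) (b : Fin N) :
    partMultiplicities mu b = mu.parts.count (b + 1 : ℕ) := rfl

lemma partMultiplicities_injective :
    Function.Injective (partMultiplicities : N.Partition → Fin N →₀ ℕ) := by
  intro mu nu h
  refine Nat.Partition.ext (Multiset.ext.mpr fun k => ?_)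
  by_cases hk : 1 ≤ k ∧ k ≤ N
  · have hcount := DFunLike.congr_fun h (⟨k - 1, by lia⟩ : Fin N)
    simpa [partMultiplicities_apply, Nat.sub_add_cancel hk.1] using hcount
  · have hzero (ρ : N.Partition) : ρ.parts.count k = 0 :=
      Multiset.count_eq_zero_of_notMem fun hm =>
        hk ⟨ρ.parts_pos hm, ρ.parts_sum ▸ Multiset.le_sum_of_mem hm⟩
    rw [hzero, hzero]

lemma weight_powerSumWeight (u : Fin N →₀ ℕ) :
    Finsupp.weight (powerSumWeight N) u = ∑ b, u b * (b + 1) := by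
  rw [Finsupp.weight_apply, Finsupp.sum_fintype _ _ (by simp)]
  rfl

lemma weight_partMultiplicities (mu : N.Partition) :
    Finsupp.weight (powerSumWeight N) (partMultiplicities mu) = N := by
  have hsum := Finset.sum_multiset_map_count mu.parts id
  rw [Multiset.map_id, mu.parts_sum] at hsum
  rw [weight_powerSumWeight]
  exact (hsum.trans (sum_toFinset_parts_eq_sum_fin mu (fun k => mu.parts.count k • k)
    fun k hk => by rw [Multiset.count_eq_zero_of_notMem hk, zero_smul])).symm

lemma exists_partMultiplicities_eq {u : Fin N →₀ ℕ}
    (hu : Finsupp.weight (powerSumWeight N) u = N) :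
    ∃ mu : N.Partition, partMultiplicities mu = u := by
  rw [weight_powerSumWeight] at hu
  refine ⟨{ parts := ∑ b : Fin N, Multiset.replicate (u b) ((b : ℕ) + 1), parts_pos := ?_,
            parts_sum := ?_ }, ?_⟩
  · intro k hk
    obtain ⟨b, -, hb⟩ := Multiset.mem_sum.mp hk
    exact Multiset.eq_of_mem_replicate hb ▸ Nat.succ_pos _
  · rw [Multiset.sum_sum]
    simpa using hu
  · ext b
    rw [partMultiplicities_apply, Multiset.count_sum', Finset.sum_eq_single b]
    · exact Multiset.count_replicate_self _ _
    · intro c _ hc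
      rw [Multiset.count_replicate, if_neg fun h => hc (Fin.ext (Nat.succ_injective h))]
    · simp

lemma psumAlgHom_monomial_partMultiplicities {n : ℕ} {R : Type*} [CommRing R]
    (mu : N.Partition) :
    psumAlgHom n N R (monomial (partMultiplicities mu) 1) = psumPart (Fin n) R mu := by
  rw [psumPart, Finset.prod_multiset_map_count, prod_toFinset_parts_eq_prod_fin mu
    (fun k => psum (Fin n) R k ^ mu.parts.count k) (fun k hk => by
      rw [Multiset.count_eq_zero_of_notMem hk, pow_zero]), psumAlgHom, aeval_monomial, map_one,
    one_mul, Finsupp.prod_fintype _ _ (by simp)]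
  rfl

lemma powerSumNormSq_partMultiplicities {R : Type*} [CommRing R] (a : R) (mu : N.Partition) :
    powerSumNormSq a (partMultiplicities mu) = (zee mu : R) * a ^ len mu := by
  have hprod := prod_toFinset_parts_eq_prod_fin mu
    (fun k => ((mu.parts.count k).factorial : R) * (a * (k : R)) ^ mu.parts.count k)
    (fun k hk => by simp [Multiset.count_eq_zero_of_notMem hk])
  simp only [powerSumNormSq, zee, len, partMultiplicities_apply, ← hprod]
  rw [← Multiset.toFinset_sum_count_eq, ← Finset.prod_pow_eq_pow_sum, Nat.cast_prod,
    ← Finset.prod_mul_distrib]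
  refine Finset.prod_congr rfl fun k _ => ?_
  push_cast
  ring

lemma eq_sum_monomial_partMultiplicities {R : Type*} [CommRing R] {f : MvPolynomial (Fin N) R}
    (hf : IsWeightedHomogeneous (powerSumWeight N) f N) :
    f = ∑ mu : N.Partition,
      coeff (partMultiplicities mu) f • monomial (partMultiplicities mu) 1 := by
  ext u
  simp only [coeff_sum, coeff_smul, coeff_monomial, smul_eq_mul, mul_ite, mul_one, mul_zero]
  by_cases hu : Finsupp.weight (powerSumWeight N) u = N
  · obtain ⟨mu, rfl⟩ := exists_partMultiplicities_eq hu
    simp only [partMultiplicities_injective.eq_iff, Finset.sum_ite_eq', Finset.mem_univ, if_true]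
  · rw [hf.coeff_eq_zero u hu, Finset.sum_eq_zero]
    refine fun mu _ => if_neg ?_
    rintro rfl
    exact hu (weight_partMultiplicities mu)

end PartitionMultiplicities

section Orthogonality

variable {n N : ℕ} (h : N ≤ n)

/-- The expression of a symmetric polynomial as a polynomial in the power sums. -/
noncomputable def toPowerSums : SymHom n N →ₗ[Qα] MvPolynomial (Fin N) Qα :=
  (powerSumBasis h).constr Qα fun mu => monomial (partMultiplicities mu) 1

lemma powerSumBasis_eq_pElt (mu : N.Partition) : powerSumBasis h mu = pElt n mu := by
  simp [powerSumBasis]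

lemma psumAlgHom_toPowerSums (f : SymHom n N) :
    psumAlgHom n N Qα (toPowerSums h f) = (f : MvPolynomial (Fin n) Qα) := by
  have hcomp : (psumAlgHom n N Qα).toLinearMap ∘ₗ toPowerSums h = (SymHom n N).subtype := by
    refine (powerSumBasis h).ext fun mu => ?_
    rw [LinearMap.comp_apply, toPowerSums, Module.Basis.constr_basis, AlgHom.toLinearMap_apply,
      psumAlgHom_monomial_partMultiplicities, Submodule.subtype_apply, powerSumBasis_apply]
  exact LinearMap.congr_fun hcomp f

lemma isWeightedHomogeneous_toPowerSums (f : SymHom n N) :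
    IsWeightedHomogeneous (powerSumWeight N) (toPowerSums h f) N := by
  rw [toPowerSums, Module.Basis.constr_apply_fintype]
  refine IsWeightedHomogeneous.sum _ _ _ fun mu _ => ?_
  rw [smul_eq_C_mul]
  exact (isWeightedHomogeneous_monomial _ _ _ (weight_partMultiplicities mu)).C_mul _

lemma jackForm_eq_powerSumForm (f g : SymHom n N) :
    jackForm h f g = powerSumForm α (toPowerSums h f) (toPowerSums h g) := by
  have hform : jackForm h = (powerSumForm α).compl₁₂ (toPowerSums h) (toPowerSums h) := by
    refine LinearMap.BilinForm.ext_basis (powerSumBasis h) fun mu nu => ?_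
    rw [LinearMap.compl₁₂_apply, toPowerSums, Module.Basis.constr_basis,
      Module.Basis.constr_basis, powerSumForm_monomial, coeff_monomial, one_mul,
      powerSumNormSq_partMultiplicities, powerSumBasis_eq_pElt, powerSumBasis_eq_pElt,
      jackForm_powerSum]
    simp only [partMultiplicities_injective.eq_iff, mul_ite, mul_one, mul_zero, eq_comm]
  rw [hform, LinearMap.compl₁₂_apply]

lemma eq_zero_of_psumAlgHom_eq_zero {h : N ≤ n} {f : MvPolynomial (Fin N) Qα}
    (hf : IsWeightedHomogeneous (powerSumWeight N) f N) (h0 : psumAlgHom n N Qα f = 0) :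
    f = 0 := by
  have hsum : ∑ mu : N.Partition, coeff (partMultiplicities mu) f • pElt n mu = 0 := by
    refine Subtype.ext ?_
    rw [Submodule.coe_sum, Submodule.coe_zero, ← h0]
    conv_rhs => rw [eq_sum_monomial_partMultiplicities hf, map_sum]
    refine Finset.sum_congr rfl fun mu _ => ?_
    rw [map_smul, psumAlgHom_monomial_partMultiplicities]
    rfl
  have hcoeff := Fintype.linearIndependent_iff.mp (pElt_linearIndependent h) _ hsum
  rw [eq_sum_monomial_partMultiplicities hf]
  exact Finset.sum_eq_zero fun mu _ => by rw [hcoeff mu, zero_smul]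

lemma laplaceBeltrami_toPowerSums {f : SymHom n N} {e : Qα}
    (hf : cherednikSq α (f : MvPolynomial (Fin n) Qα) = C e * (f : MvPolynomial (Fin n) Qα)) :
    laplaceBeltrami α (∑ i : Fin n, ((i : ℕ) : Qα) ^ 2) (toPowerSums h f) =
      e • toPowerSums h f := by
  have hw := isWeightedHomogeneous_toPowerSums h f
  have hsmul : IsWeightedHomogeneous (powerSumWeight N) (e • toPowerSums h f) N := by
    rw [smul_eq_C_mul]
    exact hw.C_mul e
  refine sub_eq_zero.mp (eq_zero_of_psumAlgHom_eq_zero (h := h)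
    ((isWeightedHomogeneous_laplaceBeltrami α _ hw).sub hsmul) ?_)
  rw [map_sub, ← cherednikSq_psumAlgHom_eq_psumAlgHom_laplaceBeltrami α hw, map_smul,
    psumAlgHom_toPowerSums, hf, smul_eq_C_mul, sub_self]

theorem jackForm_eq_zero_of_cherednikSq_eq {f g : SymHom n N} {e e' : Qα} (hne : e ≠ e')
    (hf : cherednikSq α (f : MvPolynomial (Fin n) Qα) = C e * (f : MvPolynomial (Fin n) Qα))
    (hg : cherednikSq α (g : MvPolynomial (Fin n) Qα) = C e' * (g : MvPolynomial (Fin n) Qα)) :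
    jackForm h f g = 0 := by
  have hself := isSelfAdjoint_laplaceBeltrami α (∑ i : Fin n, ((i : ℕ) : Qα) ^ 2)
    (toPowerSums h f) (toPowerSums h g)
  rw [laplaceBeltrami_toPowerSums h hf, laplaceBeltrami_toPowerSums h hg, map_smul, map_smul,
    LinearMap.smul_apply, ← jackForm_eq_powerSumForm, smul_eq_mul, smul_eq_mul] at hself
  exact (mul_eq_mul_right_iff.mp hself).resolve_left hne

end Orthogonality

section Anisotropy

variable {K ι : Type*} [Field K] [LinearOrder K] [IsStrictOrderedRing K] [Fintype ι]
  {w : ι → Polynomial K}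

lemma eq_zero_of_sum_mul_sq_eq_zero (hw : ∀ i t, 0 < t → 0 < (w i).eval t) {P : ι → Polynomial K}
    (h : ∑ i, w i * P i ^ 2 = 0) (i : ι) : P i = 0 := by
  refine Polynomial.eq_zero_of_infinite_isRoot _ ((Set.Ioi_infinite 0).mono fun t ht => ?_)
  have hsum : ∑ j, (w j).eval t * (P j).eval t ^ 2 = 0 := by
    simpa [Polynomial.eval_finsetSum] using congrArg (Polynomial.eval t) h
  have hterm := (Finset.sum_eq_zero_iff_of_nonneg fun j _ =>
    mul_nonneg (hw j t ht).le (sq_nonneg _)).mp hsum i (Finset.mem_univ i)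
  exact pow_eq_zero_iff two_ne_zero |>.mp ((mul_eq_zero.mp hterm).resolve_left (hw i t ht).ne')

lemma eq_zero_of_sum_algebraMap_mul_sq_eq_zero (hw : ∀ i t, 0 < t → 0 < (w i).eval t)
    {c : ι → RatFunc K} (h : ∑ i, algebraMap (Polynomial K) (RatFunc K) (w i) * c i ^ 2 = 0)
    (i : ι) : c i = 0 := by
  obtain ⟨⟨q, hq⟩, hint⟩ :=
    IsLocalization.exist_integer_multiples_of_finite (nonZeroDivisors (Polynomial K)) c
  choose P hP using hint
  simp only [Algebra.smul_def] at hP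
  have hsum : ∑ i, w i * P i ^ 2 = 0 := by
    apply RatFunc.algebraMap_injective K
    simp only [map_sum, map_mul, map_pow, hP, mul_pow, mul_left_comm _ (algebraMap _ _ q ^ 2),
      ← Finset.mul_sum, h, mul_zero, map_zero]
  have hmul := hP i
  rw [eq_zero_of_sum_mul_sq_eq_zero hw hsum, map_zero, eq_comm, mul_eq_zero] at hmul
  exact hmul.resolve_left (by simpa using nonZeroDivisors.ne_zero hq)

lemma zee_pos {N : ℕ} (mu : N.Partition) : 0 < zee mu :=
  Finset.prod_pos fun _ hi =>
    Nat.mul_pos (Nat.pow_pos (mu.parts_pos (Multiset.mem_toFinset.mp hi))) (Nat.factorial_pos _)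

lemma jackForm_self {n N : ℕ} (h : N ≤ n) (f : SymHom n N) :
    jackForm h f f =
      ∑ mu : N.Partition, (zee mu : Qα) * α ^ len mu * (powerSumBasis h).repr f mu ^ 2 := by
  conv_lhs => rw [← (powerSumBasis h).sum_repr f]
  simp only [map_sum, LinearMap.sum_apply, map_smul, LinearMap.smul_apply, powerSumBasis_eq_pElt,
    jackForm_powerSum, smul_eq_mul, mul_ite, mul_zero, Finset.sum_ite_eq', Finset.mem_univ,
    if_true]
  exact Finset.sum_congr rfl fun mu _ => by ring

theorem eq_zero_of_jackForm_self_eq_zero {n N : ℕ} {h : N ≤ n} {f : SymHom n N}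
    (hf : jackForm h f f = 0) : f = 0 := by
  refine (powerSumBasis h).repr.map_eq_zero_iff.mp (Finsupp.ext
    (eq_zero_of_sum_algebraMap_mul_sq_eq_zero
      (w := fun mu => (zee mu : Polynomial ℚ) * Polynomial.X ^ len mu) (fun mu t ht => ?_) ?_))
  · rw [Polynomial.eval_mul, Polynomial.eval_natCast, Polynomial.eval_pow, Polynomial.eval_X]
    exact mul_pos (Nat.cast_pos.mpr (zee_pos mu)) (pow_pos ht _)
  · simpa only [map_mul, map_natCast, map_pow, RatFunc.algebraMap_X, ← jackForm_self] using hf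

end Anisotropy

section MonomialSymmetric

variable {n N : ℕ}

lemma parts_ofSym (s : Sym (Fin n) N) :
    (Nat.Partition.ofSym s).parts = vals (Multiset.toFinsupp (s : Multiset (Fin n))) := by
  rw [vals, Multiset.toFinsupp_support, Multiset.toFinset_val]
  exact Multiset.map_congr rfl fun i _ => (Multiset.toFinsupp_apply _ i).symm

lemma prod_map_X {R σ : Type*} [CommSemiring R] [DecidableEq σ] (s : Multiset σ) :
    (s.map (X : σ → MvPolynomial σ R)).prod = monomial (Multiset.toFinsupp s) 1 := by
  induction s using Multiset.induction with
  | empty => simp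
  | cons i s ih =>
    rw [Multiset.map_cons, Multiset.prod_cons, ih, ← Multiset.singleton_add, map_add,
      Multiset.toFinsupp_singleton, X, monomial_mul, one_mul]

lemma coeff_msymm {R : Type*} [CommSemiring R] (mu : N.Partition) (d : Fin n →₀ ℕ)
    [Decidable (vals d = mu.parts)] :
    coeff d (msymm (Fin n) R mu) = if vals d = mu.parts then 1 else 0 := by
  classical
  simp only [msymm, coeff_sum, prod_map_X, coeff_monomial]
  split_ifs with hd
  · have hcard : (Finsupp.toMultiset d).card = N := by
      rw [Finsupp.card_toMultiset, ← mu.parts_sum, ← hd]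
      rfl
    have hof : Nat.Partition.ofSym (Sym.mk (Finsupp.toMultiset d) hcard) = mu := by
      refine Nat.Partition.ext ?_
      rw [parts_ofSym, Sym.coe_mk, Finsupp.toMultiset_toFinsupp, hd]
    rw [Finset.sum_eq_single ⟨Sym.mk (Finsupp.toMultiset d) hcard, hof⟩]
    · exact if_pos (Finsupp.toMultiset_toFinsupp d)
    · rintro s - hs
      refine if_neg fun hsd => hs (Subtype.ext (Sym.coe_injective ?_))
      rw [Sym.coe_mk, ← hsd]
      exact (Multiset.toFinsupp_toMultiset _).symm
    · exact fun hmem => absurd (Finset.mem_univ _) hmem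
  · refine Finset.sum_eq_zero fun s _ => if_neg ?_
    rintro rfl
    exact hd ((parts_ofSym s.1).symm.trans (congrArg Nat.Partition.parts s.2))

open Classical in
lemma IsJackFamily.coeff_expo {h : N ≤ n} {J : N.Partition → SymHom n N}
    {v : N.Partition → N.Partition → Qα} (hJ : IsJackFamily h J v) (lam mu : N.Partition) :
    coeff (expo h mu) (J lam : MvPolynomial (Fin n) Qα) =
      if DomLE mu lam then v lam mu else 0 := by
  simp only [hJ.expansion, coeff_sum, coeff_smul, coeff_msymm, vals_expo,
    ← Nat.Partition.ext_iff, smul_eq_mul, mul_ite, mul_one, mul_zero, Finset.sum_ite_eq,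
    Finset.mem_filter, Finset.mem_univ, true_and]

end MonomialSymmetric

section DominanceOrder

variable {N : ℕ}

lemma DomLE.refl (lam : N.Partition) : DomLE lam lam := fun _ => le_rfl

lemma DomLE.trans {lam mu nu : N.Partition} (h₁ : DomLE lam mu) (h₂ : DomLE mu nu) :
    DomLE lam nu := fun i => (h₁ i).trans (h₂ i)

lemma DomLE.antisymm {lam mu : N.Partition} (h₁ : DomLE lam mu) (h₂ : DomLE mu lam) :
    lam = mu :=
  eq_of_partialSum_eq (card_parts_le lam) (card_parts_le mu) fun k _ =>
    (h₁ (k + 1)).antisymm (h₂ (k + 1))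

lemma wellFounded_domLE_ne :
    WellFounded fun mu lam : N.Partition => DomLE mu lam ∧ mu ≠ lam :=
  haveI : IsTrans N.Partition fun mu lam => DomLE mu lam ∧ mu ≠ lam :=
    ⟨fun _ _ _ h₁ h₂ => ⟨h₁.1.trans h₂.1, fun h => h₁.2 (h₁.1.antisymm (h ▸ h₂.1))⟩⟩
  haveI : Std.Irrefl fun mu lam : N.Partition => DomLE mu lam ∧ mu ≠ lam := ⟨fun _ h => h.2 rfl⟩
  Finite.wellFounded_of_trans_of_irrefl _

lemma onePart_domLE (lam : N.Partition) : DomLE (onePart N) lam := by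
  refine domLE_of_sum_tsub_le fun t => ?_
  rcases t.eq_zero_or_pos with rfl | ht
  · simp only [Nat.sub_zero, Multiset.map_id', Nat.Partition.parts_sum, le_refl]
  · simp [onePart, Nat.sub_eq_zero_of_le ht]

lemma expo_onePart_le_one {n : ℕ} (h : N ≤ n) (i : Fin n) : expo h (onePart N) i ≤ 1 := by
  rcases (expo h (onePart N) i).eq_zero_or_pos with hi | hi
  · exact hi.trans_le zero_le_one
  · have hmem : expo h (onePart N) i ∈ vals (expo h (onePart N)) :=
      Multiset.mem_map_of_mem _ (Finsupp.mem_support_iff.mpr hi.ne')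
    rw [vals_expo] at hmem
    exact (Multiset.eq_of_mem_replicate hmem).le

lemma degree_expo {n : ℕ} (h : N ≤ n) (lam : N.Partition) : (expo h lam).degree = N := by
  rw [← vals_sum, vals_expo, lam.parts_sum]

end DominanceOrder

lemma exists_eq_sum_of_coordinates {K W ι : Type*} [Field K] [AddCommGroup W] [Module K W]
    {ρ : W →ₗ[K] ι → K} (hρ : Function.Injective ρ) {p : ι → Prop} [Fintype {i // p i}]
    {b : {i // p i} → W} (hb : LinearIndependent K b) (hbp : ∀ k i, ¬ p i → ρ (b k) i = 0)
    {f : W} (hf : ∀ i, ¬ p i → ρ f i = 0) : ∃ c : {i // p i} → K, f = ∑ k, c k • b k := by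
  let r : W →ₗ[K] {i // p i} → K := LinearMap.funLeft K K Subtype.val ∘ₗ ρ
  have hext {x y : W} (hx : ∀ i, ¬ p i → ρ x i = 0) (hy : ∀ i, ¬ p i → ρ y i = 0)
      (hxy : r x = r y) : x = y := by
    refine hρ (funext fun i => ?_)
    by_cases hi : p i
    · exact congrFun hxy ⟨i, hi⟩
    · rw [hx i hi, hy i hi]
  have hsum (c : {i // p i} → K) (i : ι) (hi : ¬ p i) : ρ (∑ k, c k • b k) i = 0 := by
    simp [Finset.sum_apply, hbp _ i hi]
  have hli : LinearIndependent K (r ∘ b) := by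
    rw [Fintype.linearIndependent_iff] at hb ⊢
    refine fun c hc => hb c (hext (hsum c) (fun i _ => by simp) ?_)
    rw [map_zero, map_sum, ← hc]
    exact Finset.sum_congr rfl fun k _ => map_smul _ _ _
  have hmem : r f ∈ Submodule.span K (Set.range (r ∘ b)) :=
    hli.span_eq_top_of_card_eq_finrank' (by simp) ▸ Submodule.mem_top
  obtain ⟨c, hc⟩ := (Submodule.mem_span_range_iff_exists_fun K).mp hmem
  refine ⟨c, hext hf (hsum c) ?_⟩
  rw [← hc, map_sum]
  exact Finset.sum_congr rfl fun k _ => (map_smul _ _ _).symm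

section Uniqueness

variable {n N : ℕ} {h : N ≤ n} {J : N.Partition → SymHom n N}
  {v : N.Partition → N.Partition → Qα}

lemma IsJackFamily.coeff_onePart (hJ : IsJackFamily h J v) (lam : N.Partition) :
    coeff (expo h (onePart N)) (J lam : MvPolynomial (Fin n) Qα) = N.factorial := by
  rw [hJ.coeff_expo, if_pos (onePart_domLE lam), hJ.normalized]

lemma factorial_ne_zero (N : ℕ) : (N.factorial : Qα) ≠ 0 :=
  Nat.cast_ne_zero.mpr N.factorial_ne_zero

lemma IsJackFamily.jackForm_self_ne_zero (hJ : IsJackFamily h J v) (lam : N.Partition) :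
    jackForm h (J lam) (J lam) ≠ 0 := fun h0 => by
  have hcoeff := hJ.coeff_onePart lam
  rw [eq_zero_of_jackForm_self_eq_zero h0, Submodule.coe_zero, coeff_zero] at hcoeff
  exact factorial_ne_zero N hcoeff.symm

lemma IsJackFamily.eq_zero_of_jackForm_sum_eq_zero (hJ : IsJackFamily h J v)
    {p : N.Partition → Prop} [Fintype {mu // p mu}] {c : {mu // p mu} → Qα} (nu : {mu // p mu})
    (h0 : jackForm h (∑ mu, c mu • J mu.1) (J nu.1) = 0) : c nu = 0 := by
  simp only [map_sum, LinearMap.sum_apply, map_smul, LinearMap.smul_apply, smul_eq_mul] at h0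
  rw [Finset.sum_eq_single nu] at h0
  · exact (mul_eq_zero.mp h0).resolve_right (hJ.jackForm_self_ne_zero _)
  · intro mu _ hmu
    rw [hJ.orthogonal _ _ fun heq => hmu (Subtype.ext heq), mul_zero]
  · exact fun hmem => absurd (Finset.mem_univ _) hmem

lemma IsJackFamily.exists_eq_sum (hJ : IsJackFamily h J v) {lam : N.Partition}
    [Fintype {mu // DomLE mu lam}] {f : SymHom n N}
    (hf : ∀ mu, ¬ DomLE mu lam → coeff (expo h mu) (f : MvPolynomial (Fin n) Qα) = 0) :
    ∃ c : {mu // DomLE mu lam} → Qα, f = ∑ mu, c mu • J mu.1 := by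
  refine exists_eq_sum_of_coordinates (coeffMap_injective h) (p := (DomLE · lam))
    (Fintype.linearIndependent_iff.mpr fun c hc nu => ?_) (fun mu nu hnu => ?_) hf
  · exact hJ.eq_zero_of_jackForm_sum_eq_zero nu (by rw [hc, map_zero, LinearMap.zero_apply])
  · exact (hJ.coeff_expo mu.1 nu).trans (if_neg fun hle => hnu (hle.trans mu.2))

theorem IsJackFamily.eq_of_triangular (hJ : IsJackFamily h J v) {S : N.Partition → SymHom n N}
    (htri : ∀ lam mu, ¬ DomLE mu lam → coeff (expo h mu) (S lam : MvPolynomial (Fin n) Qα) = 0)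
    (hnorm : ∀ lam, coeff (expo h (onePart N)) (S lam : MvPolynomial (Fin n) Qα) = N.factorial)
    (horth : ∀ lam mu, DomLE mu lam → mu ≠ lam → jackForm h (S lam) (S mu) = 0)
    (lam : N.Partition) : J lam = S lam := by
  classical
  induction lam using wellFounded_domLE_ne.induction with
  | _ lam ih =>
    obtain ⟨c, hc⟩ := hJ.exists_eq_sum (htri lam)
    have hc0 (mu : {mu // DomLE mu lam}) (hmu : mu.1 ≠ lam) : c mu = 0 :=
      hJ.eq_zero_of_jackForm_sum_eq_zero mu (by
        rw [← hc, ih mu.1 ⟨mu.2, hmu⟩, horth lam mu.1 mu.2 hmu])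
    have hS : S lam = c ⟨lam, DomLE.refl lam⟩ • J lam := by
      rw [hc, Finset.sum_eq_single ⟨lam, DomLE.refl lam⟩]
      · intro nu _ hnu
        rw [hc0 nu fun heq => hnu (Subtype.ext heq), zero_smul]
      · exact fun hmem => absurd (Finset.mem_univ _) hmem
    have hone := hnorm lam
    rw [hS, Submodule.coe_smul, coeff_smul, hJ.coeff_onePart, smul_eq_mul,
      mul_eq_right₀ (factorial_ne_zero N)] at hone
    rw [hS, hone, one_smul]

end Uniqueness

section Integrality

/-- The embedding `ℤ[α] → ℚ(α)`. -/
noncomputable def evalParam : Polynomial ℤ →+* Qα := (Polynomial.aeval α).toRingHom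

lemma evalParam_X : evalParam Polynomial.X = α := Polynomial.aeval_X α

lemma evalParam_injective : Function.Injective evalParam := by
  have hcomp : evalParam = (algebraMap (Polynomial ℚ) Qα).comp
      (Polynomial.mapRingHom (Int.castRingHom ℚ)) := by
    refine Polynomial.ringHom_ext (fun z => by simp) ?_
    rw [evalParam_X, RingHom.comp_apply, Polynomial.coe_mapRingHom, Polynomial.map_X,
      RatFunc.algebraMap_X]
  rw [hcomp]
  exact (RatFunc.algebraMap_injective ℚ).comp
    (Polynomial.map_injective _ (RingHom.injective_int _))

variable {n N : ℕ} {lam : N.Partition} {S : MvPolynomial (Fin n) (Polynomial ℤ)}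

lemma IsIntegralSymmetricJack.map_evalParam_mem_symHom (hS : IsIntegralSymmetricJack lam S) :
    map evalParam S ∈ SymHom n N :=
  ⟨fun σ => by rw [← map_rename, hS.isSymmetric σ], hS.isHomogeneous.map evalParam⟩

lemma IsIntegralSymmetricJack.cherednikSq_map_evalParam (hS : IsIntegralSymmetricJack lam S) :
    cherednikSq α (map evalParam S) =
      C (evalParam (jackEigenvalue n lam)) * map evalParam S := by
  rw [← evalParam_X, ← map_cherednikSq, hS.eigen, map_mul, map_C]

theorem IsJackFamily.eq_map_evalParam {h : N ≤ n} {J : N.Partition → SymHom n N}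
    {v : N.Partition → N.Partition → Qα} (hJ : IsJackFamily h J v)
    {S : N.Partition → MvPolynomial (Fin n) (Polynomial ℤ)}
    (hS : ∀ lam, IsIntegralSymmetricJack lam (S lam)) (lam : N.Partition) :
    (J lam : MvPolynomial (Fin n) Qα) = map evalParam (S lam) := by
  refine congrArg Subtype.val (hJ.eq_of_triangular
    (S := fun lam => ⟨_, (hS lam).map_evalParam_mem_symHom⟩)
    (fun lam mu hmu => ?_) (fun lam => ?_) (fun lam mu hmu hne => ?_) lam)
  · have hcoeff : coeff (expo h mu) (S lam) = 0 :=
      not_not.mp fun h0 => hmu ((hS lam).domLE _ mu (vals_expo h mu) h0)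
    rw [coeff_map, hcoeff, map_zero]
  · rw [coeff_map, (hS lam).coeff_eq_factorial _ (expo_onePart_le_one h)
      (degree_expo h (onePart N)), map_natCast]
  · exact jackForm_eq_zero_of_cherednikSq_eq h
      (fun he => hne (eq_of_domLE_of_jackEigenvalue_eq h hmu (evalParam_injective he)))
      (hS lam).cherednikSq_map_evalParam (hS mu).cherednikSq_map_evalParam

end Integrality

end JackPoly

theorem theorem2 {n N : ℕ} (h : N ≤ n) (J : N.Partition → JackPoly.SymHom n N)
    (v : N.Partition → N.Partition → JackPoly.Qα) (hJ : JackPoly.IsJackFamily h J v)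
    (lam mu : N.Partition) (hle : JackPoly.DomLE mu lam) :
    ∃ P : Polynomial ℤ, v lam mu = Polynomial.aeval JackPoly.α P := by
  cases n with
  | zero =>
    obtain rfl : N = 0 := Nat.le_zero.mp h
    refine ⟨1, ?_⟩
    rw [Subsingleton.elim mu (JackPoly.onePart 0), hJ.normalized, map_one, Nat.factorial_zero,
      Nat.cast_one]
  | succ n =>
    choose S hS using JackPoly.exists_isIntegralSymmetricJack h
    refine ⟨MvPolynomial.coeff (JackPoly.expo h mu) (S lam), ?_⟩
    have hcoeff := hJ.coeff_expo lam mu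
    rw [if_pos hle, hJ.eq_map_evalParam hS, MvPolynomial.coeff_map] at hcoeff
    exact hcoeff.symm
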